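/- Let $G\rightrightarrows M$ be a Lie groupoid with source $\alpha$, target $\beta$, identity section $\varepsilon$ and inversion $i$ (all manifolds being finite-dimensional, Hausdorff, second countable and without boundary, and all structure maps $C^\infty$), and let $\tau:AG\to M$, $A_xG=\ker T_{\varepsilon(x)}\alpha$, be its Lie algebroid. For a smooth section $X$ of $AG$ let $$\overleftarrow{X}(g)=(T_{\varepsilon(\beta(g))}l_g)(X(\beta(g))),\qquad \overrightarrow{X}(g)=-(T_{\varepsilon(\alpha(g))}r_g)\big((T_{\varepsilon(\alpha(g))}i)(X(\alpha(g)))\big)$$ be the associated left- and right-invariant vector fields, where $l_g$ and $r_g$ are left and right translation by $g$. Let $V\alpha=\ker T\alpha$, $V\beta=\ker T\beta$, and consider the vector bundle $\mathcal P^\tau G\cong V\beta\oplus_G V\alpha\to G$ with its Lie algebroid structure with anchor $(X_g,Y_g)\mapsto X_g+Y_g$ and with the bracket transported from the Lie algebroid of the Lie groupoid $G_\beta\star G_\alpha=\{(g,h,s)\in G^3:\beta(g)=\beta(h),\ \alpha(h)=\alpha(s)\}\rightrightarrows G$, with source $(g,h,s)\mapsto g$, target $(g,h,s)\mapsto s$,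 units $(g,g,g)$ and product $(g,h,s)(s,h',s')=(g,h's^{-1}h,s')$, along the isomorphism $V_g\beta\oplus V_g\alpha\to A_g(G_\beta\star G_\alpha)$, $(X_g,Y_g)\mapsto(0_g,X_g,X_g+Y_g)$; it is characterized by $[(\overrightarrow{X},\overleftarrow{Y}),(\overrightarrow{X'},\overleftarrow{Y'})]=([\overrightarrow{X},\overrightarrow{X'}],[\overleftarrow{Y},\overleftarrow{Y'}])$. Let $d$ and $\mathcal L_Z=i_Z\circ d+d\circ i_Z$ be the differential and the Lie derivatives of this Lie algebroid. The complete lift of a section $X$ of $AG$ is the section $X^{(1,1)}=(-\overrightarrow{X},\overleftarrow{X})$ of $\mathcal P^\tau G$. Let $L:G\to\mathbb R$ be a $C^\infty$ discrete Lagrangian, with Poincaré–Cartan sections $\Theta_L^-(g)(X_g,Y_g)=-X_g(L)$ and $\Omega_L=-d\Theta_L^-$; $L$ is called regular if $\Omega_L$ is symplectic, that is, closed and nondegenerate at every point. Let $X$ be a Noether symmetry of $L$ with function $f$, that is, $X$ is a smooth section of $AG$ and $f\in C^\infty(M)$ satisfies $dL(X^{(1,1)})=\beta^*f-\alpha^*f$.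 Then $$\mathcal L_{X^{(1,1)}}\Theta_L^-=d(\alpha^*f).$$ Consequently, if $L$ is regular, then the function $F=\Theta_L^-(X^{(1,1)})-\alpha^*f$ is smooth and $X^{(1,1)}$ is the Hamiltonian section of $F$ with respect to $\Omega_L$, that is, $X^{(1,1)}$ is a smooth section with $i_{X^{(1,1)}}\Omega_L=dF$, and it is the only smooth section with this property. -/

import Mathlib

open scoped Manifold ContDiff

/-- A Lie groupoid `G ⇉ M` (all structure maps are `C^∞`).  The multiplication is a total function
whose values are only meaningful on the set of composable pairs `{(g, h) | β g = α h}`; all laws,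
and the smoothness of the multiplication, are only imposed on that set. -/
structure LieGroupoid
    {E : Type*} [NormedAddCommGroup E] [NormedSpace ℝ E]
    {H : Type*} [TopologicalSpace H] (I : ModelWithCorners ℝ E H)
    {E' : Type*} [NormedAddCommGroup E'] [NormedSpace ℝ E']
    {H' : Type*} [TopologicalSpace H'] (J : ModelWithCorners ℝ E' H')
    (G : Type*) [TopologicalSpace G] [ChartedSpace H G]
    (M : Type*) [TopologicalSpace M] [ChartedSpace H' M] where
  /-- the source map `α` -/
  src : G → M
  /-- the target map `β` -/
  tgt : G → M
  /-- the multiplication `m(g, h) = gh`, meaningful when `β g = α h` -/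
  mul : G → G → G
  /-- the identity section `ε` -/
  one : M → G
  /-- the inversion `i` -/
  inv : G → G
  src_mul : ∀ g h, tgt g = src h → src (mul g h) = src g
  tgt_mul : ∀ g h, tgt g = src h → tgt (mul g h) = tgt h
  mul_assoc : ∀ g h k, tgt g = src h → tgt h = src k → mul g (mul h k) = mul (mul g h) k
  src_one : ∀ x, src (one x) = x
  tgt_one : ∀ x, tgt (one x) = x
  one_mul : ∀ g, mul (one (src g)) g = g
  mul_one : ∀ g, mul g (one (tgt g)) = g
  src_inv : ∀ g, src (inv g) = tgt g
  tgt_inv : ∀ g, tgt (inv g) = src g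
  inv_mul : ∀ g, mul (inv g) g = one (tgt g)
  mul_inv : ∀ g, mul g (inv g) = one (src g)
  isSubmersion_src : Manifold.IsSubmersion I J ∞ src
  isSubmersion_tgt : Manifold.IsSubmersion I J ∞ tgt
  contMDiff_one : ContMDiff J I ∞ one
  contMDiff_inv : ContMDiff I I ∞ inv
  contMDiffOn_mul :
    ContMDiffOn (I.prod I) I ∞ (fun p : G × G => mul p.1 p.2) {p : G × G | tgt p.1 = src p.2}

namespace LieGroupoid

noncomputable section

variable {E : Type*} [NormedAddCommGroup E] [NormedSpace ℝ E]
  {H : Type*} [TopologicalSpace H] {I : ModelWithCorners ℝ E H}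
  {E' : Type*} [NormedAddCommGroup E'] [NormedSpace ℝ E']
  {H' : Type*} [TopologicalSpace H'] {J : ModelWithCorners ℝ E' H'}
  {G : Type*} [TopologicalSpace G] [ChartedSpace H G] [IsManifold I ∞ G]
  {M : Type*} [TopologicalSpace M] [ChartedSpace H' M]

/-! ### Translations and invariant vector fields

The tangent map of `x ↦ gx` (resp. `x ↦ xk`) is only defined along the corresponding `α`-fibre
(resp. `β`-fibre), so it is a derivative within that fibre.  It is only ever applied to vectors
tangent to the fibre, on which such a derivative is uniquely determined.

In Mathlib `TangentSpace I g` is by definition the model space `E` (identified through the preferred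
chart at `g`), so that `T_g G` and `T_{g'} G` are the same type when `g = g'`. -/

/-- `T_h r_k : T_h (β⁻¹(β h)) → T_{hk} G`, for `β h = α k`, where `g = hk`. -/
def tangentRight (𝒢 : LieGroupoid I J G M) (h k g : G) :
    TangentSpace I h →L[ℝ] TangentSpace I g :=
  (mfderivWithin I I (fun x => 𝒢.mul x k) {x | 𝒢.tgt x = 𝒢.tgt h} h : E →L[ℝ] E)

/-- `T_h l_k : T_h (α⁻¹(α h)) → T_{kh} G`, for `β k = α h`, where `g = kh`. -/
def tangentLeft (𝒢 : LieGroupoid I J G M) (k h g : G) :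
    TangentSpace I h →L[ℝ] TangentSpace I g :=
  (mfderivWithin I I (fun x => 𝒢.mul k x) {x | 𝒢.src x = 𝒢.src h} h : E →L[ℝ] E)

/-- `X` is a smooth section of the Lie algebroid `τ : AG → M`, the vector bundle with fibre
`A_x G = ker T_{ε(x)} α`, a subbundle of the pull-back of `TG` by `ε`. -/
structure IsAlgebroidSection (𝒢 : LieGroupoid I J G M)
    (X : ∀ x : M, TangentSpace I (𝒢.one x)) : Prop where
  vertical : ∀ x, mfderiv I J 𝒢.src (𝒢.one x) (X x) = 0
  smooth : ContMDiff J I.tangent ∞ (fun x => (⟨𝒢.one x, X x⟩ : TangentBundle I G))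

/-- The left-invariant vector field `g ↦ (T_{ε(β g)} l_g)(X(β g))` of a section of `AG`. -/
def leftInvariant (𝒢 : LieGroupoid I J G M) (X : ∀ x : M, TangentSpace I (𝒢.one x)) (g : G) :
    TangentSpace I g :=
  𝒢.tangentLeft g (𝒢.one (𝒢.tgt g)) g (X (𝒢.tgt g))

/-- The right-invariant vector field `g ↦ -(T_{ε(α g)} r_g)((T_{ε(α g)} i)(X(α g)))` of a section
of `AG`; here `i(ε(x)) = ε(x)`. -/
def rightInvariant (𝒢 : LieGroupoid I J G M) (X : ∀ x : M, TangentSpace I (𝒢.one x)) (g : G) :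
    TangentSpace I g :=
  -𝒢.tangentRight (𝒢.one (𝒢.src g)) g g
    (mfderiv I I 𝒢.inv (𝒢.one (𝒢.src g)) (X (𝒢.src g)) : E)

/-! ### The Lie algebroid `P^τ G ≅ Vβ ⊕ Vα → G` -/

variable (I G) in
/-- Pairs `(A, B)` of (not necessarily smooth or vertical) vector fields on `G`. -/
abbrev PairField : Type _ := (∀ g : G, TangentSpace I g) × (∀ g : G, TangentSpace I g)

/-- `Z = (A, B)` is a smooth section of the vector bundle `Vβ ⊕ Vα → G`. -/
structure IsSection (𝒢 : LieGroupoid I J G M) (Z : PairField I G) : Prop where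
  vertical_fst : ∀ g, mfderiv I J 𝒢.tgt g (Z.1 g) = 0
  vertical_snd : ∀ g, mfderiv I J 𝒢.src g (Z.2 g) = 0
  smooth_fst : ContMDiff I I.tangent ∞ (fun g => (⟨g, Z.1 g⟩ : TangentBundle I G))
  smooth_snd : ContMDiff I I.tangent ∞ (fun g => (⟨g, Z.2 g⟩ : TangentBundle I G))

/-- The anchor `(A, B) ↦ A + B`. -/
def anchor (Z : PairField I G) (g : G) : TangentSpace I g := Z.1 g + Z.2 g

/-- The derivative at `g`, along `B(g) ∈ V_g α`, of the function
`h ↦ (T_h r_{h⁻¹g})(A(h))` on the `α`-fibre through `g`, with values in the fixed vector space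
`V_g β ⊆ T_g G`; here `A` is a section of `Vβ`. -/
def fiberDeriv (𝒢 : LieGroupoid I J G M) (B A : ∀ g : G, TangentSpace I g) (g : G) :
    TangentSpace I g :=
  (mfderivWithin I 𝓘(ℝ, E) (M' := E)
    (fun h => (𝒢.tangentRight h (𝒢.mul (𝒢.inv h) g) g (A h) : E))
    {h | 𝒢.src h = 𝒢.src g} g (B g) : E)

/-- The Lie bracket of sections of `Vβ ⊕ Vα → G`, transported from the Lie algebroid of the
Lie groupoid
`G_β ⋆ G_α = {(g, h, s) | β g = β h, α h = α s} ⇉ G`,  `(g, h, s)(s, h', s') = (g, h's⁻¹h, s')`,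
along the isomorphism `(A, B) ↦ (0, A, A + B)` onto `A(G_β ⋆ G_α)`.

The left-invariant vector field on `G_β ⋆ G_α` determined by `(A, B)` is
`(g, h, s) ↦ (0_g, (T r_{s⁻¹h})(A(s)), A(s) + B(s))`.  At the unit `(g, g, g)` the third component
of the bracket of two such fields is `[A + B, A' + B'](g)`, and the second one is, splitting
`(A, A + B) = (A, A) + (0, B)`, the vector `[A, A'](g) + (∇_B A')(g) - (∇_{B'} A)(g)` where `∇` is
`fiberDeriv`.  In particular, as `∇` vanishes on right-invariant fields and these commute with the
left-invariant ones, it sends a pair `(X→, Y←)`, `(X'→, Y'←)` to `([X→, X'→], [Y←, Y'←])`. -/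
def bracket (𝒢 : LieGroupoid I J G M) (Z W : PairField I G) : PairField I G :=
  let C : ∀ g : G, TangentSpace I g := fun g =>
    VectorField.mlieBracket I Z.1 W.1 g + 𝒢.fiberDeriv Z.2 W.1 g - 𝒢.fiberDeriv W.2 Z.1 g
  (C, fun g => VectorField.mlieBracket I (anchor Z) (anchor W) g - C g)

/-! ### Exterior calculus of the Lie algebroid

A `k`-section of the dual bundle is described by its values `G → ℝ` on `k` sections. Equality of
`k`-sections means equality of these values on all smooth sections. -/

/-- The differential of a function: `df(Z) = ρ(Z) f`. -/
def d₀ (φ : G → ℝ) (Z : PairField I G) (g : G) : ℝ :=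
  mfderiv I 𝓘(ℝ, ℝ) φ g (anchor Z g)

/-- The differential of a `1`-section:
`dμ(Z, W) = ρ(Z)(μ(W)) - ρ(W)(μ(Z)) - μ([Z, W])`. -/
def d₁ (𝒢 : LieGroupoid I J G M) (μ : PairField I G → G → ℝ) (Z W : PairField I G) (g : G) : ℝ :=
  d₀ (μ W) Z g - d₀ (μ Z) W g - μ (𝒢.bracket Z W) g

/-- The differential of a `2`-section. -/
def d₂ (𝒢 : LieGroupoid I J G M) (Ω : PairField I G → PairField I G → G → ℝ)
    (Z₀ Z₁ Z₂ : PairField I G) (g : G) : ℝ :=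
  d₀ (Ω Z₁ Z₂) Z₀ g - d₀ (Ω Z₀ Z₂) Z₁ g + d₀ (Ω Z₀ Z₁) Z₂ g
    - Ω (𝒢.bracket Z₀ Z₁) Z₂ g + Ω (𝒢.bracket Z₀ Z₂) Z₁ g - Ω (𝒢.bracket Z₁ Z₂) Z₀ g

/-- The Lie derivative `ℒ_Z μ = i_Z dμ + d (i_Z μ)` of a `1`-section, evaluated on `W`. -/
def lieDeriv (𝒢 : LieGroupoid I J G M) (Z : PairField I G) (μ : PairField I G → G → ℝ)
    (W : PairField I G) (g : G) : ℝ :=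
  𝒢.d₁ μ Z W g + d₀ (μ Z) W g

/-- A `2`-section is symplectic if it is closed and nondegenerate at every point. -/
structure IsSymplectic (𝒢 : LieGroupoid I J G M) (Ω : PairField I G → PairField I G → G → ℝ) :
    Prop where
  closed : ∀ Z₀ Z₁ Z₂, 𝒢.IsSection Z₀ → 𝒢.IsSection Z₁ → 𝒢.IsSection Z₂ →
    ∀ g, 𝒢.d₂ Ω Z₀ Z₁ Z₂ g = 0
  nondegenerate : ∀ g Z, 𝒢.IsSection Z → (∀ W, 𝒢.IsSection W → Ω Z W g = 0) →
    Z.1 g = 0 ∧ Z.2 g = 0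

/-! ### Discrete Lagrangians -/

/-- The complete lift `X^{(1,1)} = (-X→, X←)` of a section `X` of `AG`. -/
def completeLift (𝒢 : LieGroupoid I J G M) (X : ∀ x : M, TangentSpace I (𝒢.one x)) :
    PairField I G :=
  (fun g => -𝒢.rightInvariant X g, fun g => 𝒢.leftInvariant X g)

/-- The Poincaré–Cartan `1`-section `Θ_L^-(g)(X_g, Y_g) = -X_g(L)`. -/
def thetaMinus (L : G → ℝ) (Z : PairField I G) (g : G) : ℝ :=
  -(mfderiv I 𝓘(ℝ, ℝ) L g (Z.1 g) : ℝ)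

/-- The Poincaré–Cartan `2`-section `Ω_L = -dΘ_L^-`. -/
def omega (𝒢 : LieGroupoid I J G M) (L : G → ℝ) (Z W : PairField I G) (g : G) : ℝ :=
  -𝒢.d₁ (thetaMinus L) Z W g

/-- A discrete Lagrangian is regular if `Ω_L` is symplectic. -/
def IsRegular (𝒢 : LieGroupoid I J G M) (L : G → ℝ) : Prop := 𝒢.IsSymplectic (𝒢.omega L)

/-- The section `X` of `AG` is a Noether symmetry of `L` with function `f ∈ C^∞(M)`:
`dL(X^{(1,1)}) = β^* f - α^* f`. -/
structure IsNoetherSymmetryWith (𝒢 : LieGroupoid I J G M) (L : G → ℝ)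
    (X : ∀ x : M, TangentSpace I (𝒢.one x)) (f : M → ℝ) : Prop where
  isAlgebroidSection : 𝒢.IsAlgebroidSection X
  smooth : ContMDiff J 𝓘(ℝ, ℝ) ∞ f
  quasiInvariant : ∀ g, d₀ L (𝒢.completeLift X) g = f (𝒢.tgt g) - f (𝒢.src g)

/-- The function `F = Θ_L^-(X^{(1,1)}) - α^* f`. -/
def noetherFunction (𝒢 : LieGroupoid I J G M) (L : G → ℝ)
    (X : ∀ x : M, TangentSpace I (𝒢.one x)) (f : M → ℝ) (g : G) : ℝ :=
  thetaMinus L (𝒢.completeLift X) g - f (𝒢.src g)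

/-- `ξ` is a smooth section with `i_ξ Ω_L = dF`. -/
structure IsHamiltonianSection (𝒢 : LieGroupoid I J G M) (L : G → ℝ) (F : G → ℝ)
    (ξ : PairField I G) : Prop where
  isSection : 𝒢.IsSection ξ
  contraction : ∀ W, 𝒢.IsSection W → ∀ g, 𝒢.omega L ξ W g = d₀ F W g

end

end LieGroupoid

open Set Filter Topology

/-! Write A₀ = -X→ and B₀ = X← for the components of the complete lift, ∇ for `fiberDeriv`, and let
Z = (A, B) be any section. Expanding the Lie derivative, (ℒΘ)(Z) = -(A₀ + B₀)(A(L)) + C(L), where C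
= [A₀, A] + ∇_{B₀}A - ∇_B A₀ is the first component of the bracket of the complete lift with Z. Two
facts about ∇ make this computable: ∇_B A₀ = 0 because A₀ is right-invariant
(`fiberDeriv_neg_rightInvariant`), and ∇_{B₀}A acts on functions as the commutator of B₀ and A
because B₀ is left-invariant (`pointDeriv_fiberDeriv_leftInvariant`). With `pointDeriv_mlieBracket`
for [A₀, A], everything cancels except -A((A₀ + B₀)(L)). The Noether condition turns this into
-A(β^*f - α^*f) = A(α^*f), since A is tangent to the β-fibres; as B is tangent to the α-fibres, this
is d(α^*f)(Z).

Contracting Ω = -dΘ with the complete lift gives d(Θ(X^{(1,1)})) - ℒΘ = dF by Cartan's formula. Two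
Hamiltonian sections of F differ by a section in the kernel of Ω at every point, which vanishes by
nondegeneracy; this needs additivity of Ω in its first argument, hence of the bracket and of ∇.

The analytic difficulty is that translations live only on fibres, where a derivative within the
fibre is determined only on tangent vectors. Submersions provide smooth local retractions onto
fibres (`exists_fibre_retraction`). These extend translations to smooth families on open sets and
push curves into fibres, so that two derivatives within a fibre can be compared along curves
(`fibre_derivative_unique`). -/

/-- A map sending `v` to `w` sends the line through `v` to the line through `w`. -/
theorem ContinuousLinearMap.toSpanSingleton_eq_comp {V W : Type*} [NormedAddCommGroup V]
    [NormedSpace ℝ V] [NormedAddCommGroup W] [NormedSpace ℝ W] {T : V →L[ℝ] W} {v : V} {w : W}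
    (h : T v = w) : T.comp (toSpanSingleton ℝ v) = toSpanSingleton ℝ w := by
  ext; simp [h]

theorem ContinuousLinearMap.toSpanSingleton_prod {V W : Type*} [NormedAddCommGroup V]
    [NormedSpace ℝ V] [NormedAddCommGroup W] [NormedSpace ℝ W] (v : V) (w : W) :
    (toSpanSingleton ℝ v).prod (toSpanSingleton ℝ w) = toSpanSingleton ℝ (v, w) := by
  ext <;> simp

/-! ### Fibres of submersions: retractions, curves and derivatives -/

section Submersion

variable {E : Type*} [NormedAddCommGroup E] [NormedSpace ℝ E]
  {H : Type*} [TopologicalSpace H] {I : ModelWithCorners ℝ E H}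
  {E' : Type*} [NormedAddCommGroup E'] [NormedSpace ℝ E']
  {H' : Type*} [TopologicalSpace H'] {J : ModelWithCorners ℝ E' H'}
  {G : Type*} [TopologicalSpace G] [ChartedSpace H G]
  {M : Type*} [TopologicalSpace M] [ChartedSpace H' M]
  {E'' : Type*} [NormedAddCommGroup E''] [NormedSpace ℝ E'']
  {H'' : Type*} [TopologicalSpace H''] {I'' : ModelWithCorners ℝ E'' H''}
  {N : Type*} [TopologicalSpace N] [ChartedSpace H'' N]

/-- Near a point, a submersion `s` admits a smooth family of retractions onto its fibres. -/
theorem Manifold.IsSubmersionAt.exists_fibre_retraction [I.Boundaryless]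
    {s : G → M} {g : G} (h : Manifold.IsSubmersionAt I J ∞ s g) :
    ∃ p : G → M → G, ContMDiffAt (I.prod J) I ∞ (Function.uncurry p) (g, s g) ∧
      (∀ᶠ z : G × M in 𝓝 (g, s g), s (p z.1 z.2) = z.2) ∧ ∀ᶠ x in 𝓝 g, p x (s x) = x := by
  set φ := h.domChart.extend I with hφ
  set ψ := h.codChart.extend J with hψ
  have hw : ∀ v ∈ φ.target, ψ (s (φ.symm v)) = (h.equiv v).1 := fun v hv => h.writtenInCharts hv
  have hφsrc : φ.source = h.domChart.source := h.domChart.extend_source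
  have hψsrc : ψ.source = h.codChart.source := h.codChart.extend_source
  have hms : ∀ x ∈ φ.source, s x ∈ ψ.source := fun x hx => by
    rw [hψsrc]; exact h.source_subset_preimage_source (hφsrc ▸ hx)
  have hg : g ∈ φ.source := hφsrc ▸ h.mem_domChart_source
  have hid : ∀ x ∈ φ.source, φ.symm (h.equiv.symm (ψ (s x), (h.equiv (φ x)).2)) = x := by
    intro x hx
    have h1 := hw (φ x) (φ.map_source hx)
    rw [φ.left_inv hx] at h1
    rw [h1, Prod.mk.eta, h.equiv.symm_apply_apply, φ.left_inv hx]
  have hid' : h.equiv.symm (ψ (s g), (h.equiv (φ g)).2) = φ g := by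
    have h1 := hw (φ g) (φ.map_source hg)
    rw [φ.left_inv hg] at h1
    rw [h1, Prod.mk.eta, h.equiv.symm_apply_apply]
  have hφg : ContMDiffAt I 𝓘(ℝ, E) ∞ φ g :=
    h.domChart.contMDiffAt_extend h.domChart_mem_maximalAtlas h.mem_domChart_source
  have hψg : ContMDiffAt J 𝓘(ℝ, E') ∞ ψ (s g) :=
    h.codChart.contMDiffAt_extend h.codChart_mem_maximalAtlas h.mem_codChart_source
  have htn : φ.target ∈ 𝓝 (φ g) :=
    (h.domChart.isOpen_extend_target).mem_nhds (φ.map_source hg)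
  have hφs : ContMDiffAt 𝓘(ℝ, E) I ∞ φ.symm (φ g) := by
    have := contMDiffOn_extend_symm h.domChart_mem_maximalAtlas
    refine this.contMDiffAt ?_
    rwa [← OpenPartialHomeomorph.extend_target']
  have hpair : ContMDiffAt (I.prod J) 𝓘(ℝ, E) ∞
      (fun z : G × M => h.equiv.symm (ψ z.2, (h.equiv (φ z.1)).2)) (g, s g) := by
    have h1 : ContMDiffAt (I.prod J) 𝓘(ℝ, E) ∞ (fun z : G × M => φ z.1) (g, s g) :=
      ContMDiffAt.comp (g, s g) hφg contMDiffAt_fst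
    have h2 : ContMDiffAt (I.prod J) 𝓘(ℝ, E') ∞ (fun z : G × M => ψ z.2) (g, s g) :=
      ContMDiffAt.comp (g, s g) hψg contMDiffAt_snd
    have h3 : ContDiff ℝ ∞ (fun q : E' × E => h.equiv.symm (q.1, (h.equiv q.2).2)) := by fun_prop
    exact ContMDiffAt.comp (g, s g) (g := fun q : E' × E => h.equiv.symm (q.1, (h.equiv q.2).2))
      (f := fun z : G × M => (ψ z.2, φ z.1)) h3.contMDiff.contMDiffAt (h2.prodMk_space h1)
  -- In the normal form of the submersion, `s` is the first component of `h.equiv`. The retraction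
  -- keeps the second component of `x` and replaces the first by the coordinate of `y`.
  refine ⟨fun x y => φ.symm (h.equiv.symm (ψ y, (h.equiv (φ x)).2)), ?_, ?_, ?_⟩
  · refine ContMDiffAt.comp (g, s g) (f := fun z : G × M =>
      h.equiv.symm (ψ z.2, (h.equiv (φ z.1)).2)) (g := φ.symm) ?_ hpair
    simpa only [hid'] using hφs
  · have hc := hpair.continuousAt
    have h1 : ∀ᶠ z : G × M in 𝓝 (g, s g),
        h.equiv.symm (ψ z.2, (h.equiv (φ z.1)).2) ∈ φ.target :=
      hc.eventually_mem (by simpa only [hid'] using htn)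
    have h2 : ∀ᶠ z : G × M in 𝓝 (g, s g), z.2 ∈ ψ.source :=
      continuousAt_snd.eventually_mem (by
        rw [hψsrc]; exact h.codChart.open_source.mem_nhds h.mem_codChart_source)
    filter_upwards [h1, h2] with z hz1 hz2
    have h3 := hw _ hz1
    rw [h.equiv.apply_symm_apply] at h3
    exact ψ.injOn (hms _ (φ.map_target hz1)) hz2 h3
  · have : ∀ᶠ x in 𝓝 g, x ∈ φ.source := by
      rw [hφsrc]; exact h.domChart.open_source.mem_nhds h.mem_domChart_source
    exact this.mono hid

/-- Every tangent vector is the velocity of a smooth curve. -/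
theorem exists_contMDiffAt_curve [IsManifold I ∞ G] [I.Boundaryless] (g : G)
    (w : TangentSpace I g) :
    ∃ c : ℝ → G, c 0 = g ∧ ContMDiffAt 𝓘(ℝ, ℝ) I ∞ c 0 ∧
      HasMFDerivAt 𝓘(ℝ, ℝ) I c 0 (ContinuousLinearMap.toSpanSingleton ℝ (w : E) : ℝ →L[ℝ] E) := by
  set φ := extChartAt I g
  set v : E := mfderiv I 𝓘(ℝ, E) φ g w
  have hsymm : ContMDiffAt 𝓘(ℝ, E) I ∞ φ.symm (φ g) :=
    (contMDiffOn_extChartAt_symm g).contMDiffAt (extChartAt_target_mem_nhds g)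
  have hl : ContMDiffAt 𝓘(ℝ, ℝ) 𝓘(ℝ, E) ∞ (fun t : ℝ => φ g + t • v) 0 := by
    refine ContDiffAt.contMDiffAt ?_
    fun_prop
  have hl0 : φ g + (0 : ℝ) • v = φ g := by simp
  have hld : HasMFDerivAt 𝓘(ℝ, ℝ) 𝓘(ℝ, E) (fun t : ℝ => φ g + t • v) 0
      (ContinuousLinearMap.toSpanSingleton ℝ v : ℝ →L[ℝ] E) := by
    refine HasFDerivAt.hasMFDerivAt ?_
    exact ((ContinuousLinearMap.toSpanSingleton ℝ v).hasFDerivAt).const_add (φ g)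
  have hs := (hsymm.mdifferentiableAt (by simp)).hasMFDerivAt
  have hs' : HasMFDerivAt 𝓘(ℝ, E) I φ.symm (φ g + (0 : ℝ) • v)
      (mfderiv 𝓘(ℝ, E) I φ.symm (φ g) : E →L[ℝ] E) := by
    rw [hl0]; exact hs
  refine ⟨fun t => φ.symm (φ g + t • v), ?_, ?_, ?_⟩
  · simp [φ]
  · refine ContMDiffAt.comp (0 : ℝ) (g := φ.symm) ?_ hl
    simpa only [hl0] using hsymm
  · have := HasMFDerivAt.comp (0 : ℝ) hs' hld
    have key : (mfderiv 𝓘(ℝ, E) I φ.symm (φ g) : E →L[ℝ] E) v = w := by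
      have h1 := mfderivWithin_extChartAt_symm_comp_mfderiv_extChartAt'
        (I := I) (mem_extChartAt_source (I := I) g)
      rw [I.range_eq_univ, mfderivWithin_univ] at h1
      exact DFunLike.congr_fun h1 w
    exact this.congr_mfderiv (ContinuousLinearMap.toSpanSingleton_eq_comp
      (V := E) (W := E) (T := (mfderiv 𝓘(ℝ, E) I φ.symm (φ g) : E →L[ℝ] E)) (v := v) (w := (w : E)) key)

/-- Chain rule along a curve contained in a set. -/
theorem HasMFDerivWithinAt.comp_curve {f : G → N} {S : Set G} {c : ℝ → G} {t : ℝ} {x : G} {w : E}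
    {D : E →L[ℝ] E''} (hf : HasMFDerivWithinAt I I'' f S x D)
    (hc : HasMFDerivAt 𝓘(ℝ, ℝ) I c t (ContinuousLinearMap.toSpanSingleton ℝ w : ℝ →L[ℝ] E))
    (hx : c t = x) (hS : ∀ r, c r ∈ S) :
    HasMFDerivAt 𝓘(ℝ, ℝ) I'' (fun r => f (c r)) t
      (ContinuousLinearMap.toSpanSingleton ℝ (D w) : ℝ →L[ℝ] E'') := by
  subst hx
  exact hasMFDerivWithinAt_univ.1 ((HasMFDerivWithinAt.comp t hf (hasMFDerivWithinAt_univ.2 hc)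
    (fun r _ => hS r)).congr_mfderiv (ContinuousLinearMap.toSpanSingleton_eq_comp
      (T := D) (v := w) (w := D w) rfl))

/-- Chain rule along a curve. -/
theorem HasMFDerivAt.comp_curve {f : G → N} {c : ℝ → G} {t : ℝ} {x : G} {w : E}
    {D : E →L[ℝ] E''} (hf : HasMFDerivAt I I'' f x D)
    (hc : HasMFDerivAt 𝓘(ℝ, ℝ) I c t (ContinuousLinearMap.toSpanSingleton ℝ w : ℝ →L[ℝ] E))
    (hx : c t = x) :
    HasMFDerivAt 𝓘(ℝ, ℝ) I'' (fun r => f (c r)) t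
      (ContinuousLinearMap.toSpanSingleton ℝ (D w) : ℝ →L[ℝ] E'') :=
  (hasMFDerivWithinAt_univ.2 hf).comp_curve hc hx fun _ => mem_univ _

/-- A curve has an unambiguous velocity, the value of its derivative at 1. Restricting to curves
thus gives uniqueness where derivatives within a fibre are not unique as linear maps. -/
theorem HasMFDerivAt.curve_velocity_unique {c : ℝ → G} {t : ℝ} {v w : E}
    (hv : HasMFDerivAt 𝓘(ℝ, ℝ) I c t (ContinuousLinearMap.toSpanSingleton ℝ v : ℝ →L[ℝ] E))
    (hw : HasMFDerivAt 𝓘(ℝ, ℝ) I c t (ContinuousLinearMap.toSpanSingleton ℝ w : ℝ →L[ℝ] E)) :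
    v = w := by
  have h := hasMFDerivAt_unique hv hw
  have h1 : (ContinuousLinearMap.toSpanSingleton ℝ v : ℝ →L[ℝ] E) 1 =
    (ContinuousLinearMap.toSpanSingleton ℝ w : ℝ →L[ℝ] E) 1 := DFunLike.congr_fun h (1 : ℝ)
  simpa using h1

/-- Every vector tangent to a fibre of a submersion is the velocity of a smooth curve in it. -/
theorem Manifold.IsSubmersionAt.exists_curve_in_fibre [IsManifold I ∞ G] [I.Boundaryless]
    {s : G → M} {g : G} (h : Manifold.IsSubmersionAt I J ∞ s g)
    (w : TangentSpace I g) (hw : mfderiv I J s g w = 0) :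
    ∃ c : ℝ → G, c 0 = g ∧ ContMDiffAt 𝓘(ℝ, ℝ) I ∞ c 0 ∧
      HasMFDerivAt 𝓘(ℝ, ℝ) I c 0 (ContinuousLinearMap.toSpanSingleton ℝ (w : E) : ℝ →L[ℝ] E) ∧
      ∀ t, s (c t) = s g := by
  obtain ⟨p, hp, hps, hpid⟩ := h.exists_fibre_retraction
  obtain ⟨γ, hγ0, hγ, hγw⟩ := exists_contMDiffAt_curve (I := I) g w
  subst hγ0
  have hsγ : HasMFDerivAt 𝓘(ℝ, ℝ) J (fun t => s (γ t)) 0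
      (ContinuousLinearMap.toSpanSingleton ℝ (0 : E') : ℝ →L[ℝ] E') := by
    have := ((h.contMDiffAt.mdifferentiableAt (by simp)).hasMFDerivAt).comp_curve hγw rfl
    exact this.congr_mfderiv (congrArg (ContinuousLinearMap.toSpanSingleton (M₁ := E') ℝ) hw)
  have hpd := (hp.mdifferentiableAt (by simp)).hasMFDerivAt
  have hpair : ∀ y : ℝ → M, y 0 = s (γ 0) →
      HasMFDerivAt 𝓘(ℝ, ℝ) J y 0 (ContinuousLinearMap.toSpanSingleton ℝ (0 : E') : ℝ →L[ℝ] E') →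
      HasMFDerivAt 𝓘(ℝ, ℝ) I (fun t => p (γ t) (y t)) 0
        (ContinuousLinearMap.toSpanSingleton ℝ
          ((mfderiv (I.prod J) I (Function.uncurry p) (γ 0, s (γ 0)) :
            E × E' →L[ℝ] E) (w, 0)) : ℝ →L[ℝ] E) := by
    intro y hy hyd
    have h1 : HasMFDerivAt 𝓘(ℝ, ℝ) (I.prod J) (fun t => (γ t, y t)) 0
        (ContinuousLinearMap.toSpanSingleton ℝ ((w, 0) : E × E') : ℝ →L[ℝ] E × E') := by
      refine (hγw.prodMk hyd).congr_mfderiv ?_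
      exact ContinuousLinearMap.toSpanSingleton_prod (V := E) (W := E') w 0
    exact hpd.comp_curve h1 (by rw [hy])
  -- Since `s ∘ γ` has velocity zero, the curves `p (γ t) (s (γ 0))` and `p (γ t) (s (γ t))` have
  -- the same velocity at 0; the second is `γ` near 0, so the first has velocity `w`.
  have hd1 := hpair (fun _ => s (γ 0)) rfl (by
    refine (hasMFDerivAt_const _ _).congr_mfderiv ?_
    exact (ContinuousLinearMap.toSpanSingleton_zero ℝ).symm)
  have hd2 := hpair (fun t => s (γ t)) rfl hsγ
  have heq2 : (fun t => p (γ t) (s (γ t))) =ᶠ[𝓝 0] γ :=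
    hγ.continuousAt.eventually hpid
  have hval := (hd2.congr_of_eventuallyEq heq2.symm).curve_velocity_unique hγw
  rw [hval] at hd1
  classical
  have hcont : ContMDiffAt 𝓘(ℝ, ℝ) I ∞ (fun t => p (γ t) (s (γ 0))) 0 :=
    ContMDiffAt.comp (0 : ℝ) (g := Function.uncurry p) (f := fun t => (γ t, s (γ 0))) hp
      (hγ.prodMk contMDiffAt_const)
  have hev : ∀ᶠ t in 𝓝 (0 : ℝ), s (p (γ t) (s (γ 0))) = s (γ 0) := by
    have : Tendsto (fun t : ℝ => (γ t, s (γ 0))) (𝓝 0) (𝓝 (γ 0, s (γ 0))) :=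
      hγ.continuousAt.prodMk continuousAt_const
    exact this.eventually hps
  -- The retracted curve is known to lie in the fibre only for `t` near 0. The constant value `γ 0`
  -- elsewhere keeps the curve in the fibre for all `t` and leaves its germ at 0 unchanged.
  have hceq : (fun t => if s (p (γ t) (s (γ 0))) = s (γ 0) then p (γ t) (s (γ 0)) else γ 0)
      =ᶠ[𝓝 0] fun t => p (γ t) (s (γ 0)) := hev.mono fun t ht => if_pos ht
  have hp0 : p (γ 0) (s (γ 0)) = γ 0 := hpid.self_of_nhds
  refine ⟨fun t => if s (p (γ t) (s (γ 0))) = s (γ 0) then p (γ t) (s (γ 0)) else γ 0,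
    ?_, hcont.congr_of_eventuallyEq hceq, hd1.congr_of_eventuallyEq hceq, fun t => ?_⟩
  · simp [hp0]
  · dsimp only
    split_ifs with ht
    exacts [ht, rfl]

/-- A derivative within a fibre of a submersion is uniquely determined on the vectors tangent to
the fibre. -/
theorem Manifold.IsSubmersionAt.fibre_derivative_unique [IsManifold I ∞ G] [I.Boundaryless]
    {s : G → M} {g : G} (h : Manifold.IsSubmersionAt I J ∞ s g) {f : G → N}
    {D D' : E →L[ℝ] E''} (hD : HasMFDerivWithinAt I I'' f {x | s x = s g} g D)
    (hD' : HasMFDerivWithinAt I I'' f {x | s x = s g} g D')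
    (w : TangentSpace I g) (hw : mfderiv I J s g w = 0) : D (w : E) = D' (w : E) := by
  obtain ⟨c, hc0, -, hcd, hcs⟩ := h.exists_curve_in_fibre w hw
  exact (hD.comp_curve hcd hc0 hcs).curve_velocity_unique (hD'.comp_curve hcd hc0 hcs)

end Submersion

/-- The derivative of a vector-valued function, as a linear map between model spaces. -/
noncomputable def pointDeriv {E : Type*} [NormedAddCommGroup E] [NormedSpace ℝ E]
    {H : Type*} [TopologicalSpace H] (I : ModelWithCorners ℝ E H)
    {G : Type*} [TopologicalSpace G] [ChartedSpace H G]
    {F : Type*} [NormedAddCommGroup F] [NormedSpace ℝ F] (h : G → F) (g : G) : E →L[ℝ] F :=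
  mfderiv I 𝓘(ℝ, F) h g

/-! ### Smooth families of tangent vectors -/

section TangentSections

variable {E : Type*} [NormedAddCommGroup E] [NormedSpace ℝ E]
  {H : Type*} [TopologicalSpace H] {I : ModelWithCorners ℝ E H}
  {E' : Type*} [NormedAddCommGroup E'] [NormedSpace ℝ E']
  {H' : Type*} [TopologicalSpace H'] {J : ModelWithCorners ℝ E' H'}
  {G : Type*} [TopologicalSpace G] [ChartedSpace H G]
  {M : Type*} [TopologicalSpace M] [ChartedSpace H' M]
  {E'' : Type*} [NormedAddCommGroup E''] [NormedSpace ℝ E'']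
  {H'' : Type*} [TopologicalSpace H''] {I'' : ModelWithCorners ℝ E'' H''}
  {N : Type*} [TopologicalSpace N] [ChartedSpace H'' N]

/-- The partial derivatives of a smooth family of maps `f x : M → N`, evaluated on a smooth family
of tangent vectors, depend smoothly on the parameter. -/
theorem ContMDiffAt.mfderiv_family_apply [IsManifold I ∞ G] [IsManifold J ∞ M]
    [IsManifold I'' ∞ N] {f : G → M → N} {b : G → M}
    {v : ∀ x : G, TangentSpace J (b x)} {x₀ : G}
    (hf : ContMDiffAt (I.prod J) I'' ∞ (Function.uncurry f) (x₀, b x₀))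
    (hv : ContMDiffAt I J.tangent ∞ (fun x => (⟨b x, v x⟩ : TangentBundle J M)) x₀) :
    ContMDiffAt I I''.tangent ∞
      (fun x => (⟨f x (b x), mfderiv J I'' (f x) (b x) (v x)⟩ : TangentBundle I'' N)) x₀ := by
  have hb : ContMDiffAt I J ∞ b x₀ := by
    have := (Bundle.contMDiff_proj (TangentSpace J : M → Type _) (n := ∞)
      (IB := J)).contMDiffAt.comp x₀ hv
    exact this
  have h1 := hf.mfderiv f b hb (m := ∞) (by simp)
  refine ContMDiffAt.clm_apply_of_inCoordinates (b₁ := b) (b₂ := fun x => f x (b x))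
    (ϕ := fun x => mfderiv J I'' (f x) (b x)) h1 hv ?_
  exact ContMDiffAt.comp x₀ (g := Function.uncurry f) (f := fun x => (x, b x)) hf
    (contMDiffAt_id.prodMk hb)

/-- The constant family `L` in the preceding lemma, followed by the projection of the tangent bundle
of ℝ to its vector part. -/
theorem ContMDiffAt.mfderiv_apply_section [IsManifold I ∞ G] {L : G → ℝ}
    (hL : ContMDiff I 𝓘(ℝ, ℝ) ∞ L) {V : ∀ x : G, TangentSpace I x} {x₀ : G}
    (hV : ContMDiffAt I I.tangent ∞ (fun x => (⟨x, V x⟩ : TangentBundle I G)) x₀) :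
    ContMDiffAt I 𝓘(ℝ, ℝ) ∞ (fun x => pointDeriv I L x (V x)) x₀ := by
  have h1 := ContMDiffAt.mfderiv_family_apply (I := I) (J := I) (I'' := 𝓘(ℝ, ℝ))
    (f := fun _ => L) (b := id) (v := V) (x₀ := x₀)
    (ContMDiffAt.comp (x₀, x₀) (g := L) (f := Prod.snd) hL.contMDiffAt contMDiffAt_snd) hV
  exact (contMDiff_snd_tangentBundle_modelSpace ℝ 𝓘(ℝ, ℝ)).contMDiffAt.comp x₀ h1

/-- In the trivialization at `x`, a tangent vector at `x` is represented by itself. -/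
theorem TangentBundle.trivializationAt_self_snd [IsManifold I 1 G] (x y : G) (v : E) (h : y = x) :
    (trivializationAt E (TangentSpace I) x (⟨y, v⟩ : TangentBundle I G)).2 = v := by
  subst h
  exact (tangentBundleCore I G).coordChange_self (achart H y) y (mem_achart_source H y) v

end TangentSections

/-! ### Second derivatives and the Lie bracket in charts -/

/-- Product rule and symmetry of second derivatives for the partial derivative of a function of
a real parameter and a vector, along a curve of vectors. -/
theorem ContDiffAt.hasDerivAt_partial_fderiv {E : Type*} [NormedAddCommGroup E] [NormedSpace ℝ E]
    {Φ : ℝ → E → ℝ} {u : E} (hΦ : ContDiffAt ℝ 2 (Function.uncurry Φ) (0, u))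
    {a : ℝ → E} {a' : E} (ha : HasDerivAt a a' 0) :
    DifferentiableAt ℝ (fun v => deriv (fun t => Φ t v) 0) u ∧
    HasDerivAt (fun t => fderiv ℝ (Φ t) u (a t))
      (fderiv ℝ (fun v => deriv (fun t => Φ t v) 0) u (a 0) + fderiv ℝ (Φ 0) u a') 0 := by
  set F := Function.uncurry Φ
  have hd : ∀ᶠ z in 𝓝 ((0 : ℝ), u), DifferentiableAt ℝ F z := by
    have h1 := hΦ.eventually (by simp)
    exact h1.mono fun z hz => hz.differentiableAt (by simp)
  have hF' : DifferentiableAt ℝ (fderiv ℝ F) (0, u) :=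
    (hΦ.fderiv_right (m := 1) (by norm_num)).differentiableAt (by simp)
  have hsymm : IsSymmSndFDerivAt ℝ F (0, u) := hΦ.isSymmSndFDerivAt (by simp)
  -- Both partial derivatives are restrictions of the total derivative of `F`, so the mixed terms
  -- become values of the symmetric second derivative of `F`.
  have hleft : ∀ t v, DifferentiableAt ℝ F (t, v) →
      fderiv ℝ (Φ t) v = (fderiv ℝ F (t, v)).comp (ContinuousLinearMap.inr ℝ ℝ E) := by
    intro t v h
    exact (h.hasFDerivAt.comp v (hasFDerivAt_prodMk_right t v)).fderiv
  have hright : ∀ v, DifferentiableAt ℝ F (0, v) →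
      deriv (fun t => Φ t v) 0 = fderiv ℝ F (0, v) (1, 0) := by
    intro v h
    have := (h.hasFDerivAt.comp (0 : ℝ) (hasFDerivAt_prodMk_left (0 : ℝ) v)).hasDerivAt
    simpa [F, Function.comp_def] using this.deriv
  have ht : Tendsto (fun t : ℝ => (t, u)) (𝓝 0) (𝓝 (0, u)) :=
    (continuous_id.prodMk continuous_const).tendsto' _ _ rfl
  have hv : Tendsto (fun v : E => ((0 : ℝ), v)) (𝓝 u) (𝓝 (0, u)) :=
    (continuous_const.prodMk continuous_id).tendsto' _ _ rfl
  have e1 : (fun t => fderiv ℝ (Φ t) u (a t)) =ᶠ[𝓝 0] fun t => fderiv ℝ F (t, u) (0, a t) := by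
    filter_upwards [ht.eventually hd] with t h
    rw [hleft t u h]; simp
  have e2 : (fun v => deriv (fun t => Φ t v) 0) =ᶠ[𝓝 u] fun v => fderiv ℝ F (0, v) (1, 0) := by
    filter_upwards [hv.eventually hd] with v h using hright v h
  have h0 : HasFDerivAt (fun v => fderiv ℝ F (0, v)) _ u :=
    HasFDerivAt.comp u (g := fderiv ℝ F) hF'.hasFDerivAt (hasFDerivAt_prodMk_right (0 : ℝ) u)
  have h0' := h0.clm_apply (hasFDerivAt_const ((1 : ℝ), (0 : E)) u)
  have d2 : fderiv ℝ (fun v => deriv (fun t => Φ t v) 0) u (a 0) =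
      fderiv ℝ (fderiv ℝ F) (0, u) (0, a 0) (1, 0) := by
    rw [e2.fderiv_eq, h0'.fderiv]
    simp
  refine ⟨h0'.differentiableAt.congr_of_eventuallyEq e2,
    HasDerivAt.congr_of_eventuallyEq ?_ e1⟩
  have h1 : HasDerivAt (fun t : ℝ => fderiv ℝ F (t, u)) (fderiv ℝ (fderiv ℝ F) (0, u) (1, 0)) 0 := by
    have := (HasFDerivAt.comp (0 : ℝ) (g := fderiv ℝ F) hF'.hasFDerivAt
      (hasFDerivAt_prodMk_left (0 : ℝ) u)).hasDerivAt
    simpa [Function.comp_def] using this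
  have h2 : HasDerivAt (fun t : ℝ => ((0 : ℝ), a t)) (0, a') 0 :=
    (hasDerivAt_const (0 : ℝ) (0 : ℝ)).prodMk ha
  have h3 := h1.clm_apply h2
  rw [d2, hleft 0 u hd.self_of_nhds, hsymm.eq]
  simpa using h3

section ChartComputations

variable {E : Type*} [NormedAddCommGroup E] [NormedSpace ℝ E]
  {H : Type*} [TopologicalSpace H] {I : ModelWithCorners ℝ E H}
  {G : Type*} [TopologicalSpace G] [ChartedSpace H G] [IsManifold I ∞ G]
  {F : Type*} [NormedAddCommGroup F] [NormedSpace ℝ F]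

-- The tangent space at `g` is the model space seen through the preferred chart at `g`, so in that
-- chart the manifold derivative at `g` is the ordinary one, with no correction factor.
omit [IsManifold I ∞ G] in
theorem HasMFDerivAt.hasFDerivAt_comp_extChartAt_symm [I.Boundaryless] {h : G → F} {g : G}
    {D : E →L[ℝ] F} (hD : HasMFDerivAt I 𝓘(ℝ, F) h g D) :
    HasFDerivAt (h ∘ (extChartAt I g).symm) D (extChartAt I g g) := by
  have h1 : HasFDerivWithinAt (h ∘ (extChartAt I g).symm) D (range I) (extChartAt I g g) := hD.2
  rwa [I.range_eq_univ, hasFDerivWithinAt_univ] at h1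

theorem HasFDerivAt.hasMFDerivAt_of_comp_extChartAt_symm {h : G → F} {g : G}
    {D : E →L[ℝ] F} (hD : HasFDerivAt (h ∘ (extChartAt I g).symm) D (extChartAt I g g)) :
    HasMFDerivAt I 𝓘(ℝ, F) h g D := by
  have h1 : HasMFDerivAt I 𝓘(ℝ, E) (extChartAt I g) g (ContinuousLinearMap.id ℝ E) := by
    have := (contMDiffAt_extChartAt (I := I) (n := ∞) (x := g)).mdifferentiableAt
      (by simp) |>.hasMFDerivAt
    exact this.congr_mfderiv mfderiv_extChartAt_self
  have h2 := HasMFDerivAt.comp g hD.hasMFDerivAt h1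
  refine (h2.congr_of_eventuallyEq ?_).congr_mfderiv (ContinuousLinearMap.comp_id D)
  filter_upwards [extChartAt_source_mem_nhds (I := I) g] with x hx
  exact congrArg h ((extChartAt I g).left_inv hx).symm

omit [IsManifold I ∞ G] in
theorem MDifferentiableAt.mfderiv_eq_fderiv_comp_extChartAt_symm [I.Boundaryless] {h : G → F}
    {g : G} (hh : MDifferentiableAt I 𝓘(ℝ, F) h g) :
    pointDeriv I h g =
      fderiv ℝ (h ∘ (extChartAt I g).symm) (extChartAt I g g) :=
  hh.hasMFDerivAt.hasFDerivAt_comp_extChartAt_symm.fderiv.symm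

/-- Product rule and symmetry of second derivatives for a function of a real parameter and a point
of a manifold, along a curve of tangent vectors at a fixed point. -/
theorem ContMDiffAt.hasDerivAt_partial_mfderiv [I.Boundaryless] {f : ℝ → G → ℝ} {g : G}
    (hf : ContMDiffAt (𝓘(ℝ, ℝ).prod I) 𝓘(ℝ, ℝ) ∞ (Function.uncurry f) (0, g))
    {a : ℝ → E} {a' : E} (ha : HasDerivAt a a' 0) :
    MDifferentiableAt I 𝓘(ℝ, ℝ) (fun y => deriv (fun t => f t y) 0) g ∧
    HasDerivAt (fun t => pointDeriv I (f t) g (a t))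
      (pointDeriv I (fun y => deriv (fun t => f t y) 0) g (a 0) + pointDeriv I (f 0) g a') 0 := by
  set φ := extChartAt I g
  have hsymm : ContMDiffAt 𝓘(ℝ, E) I ∞ φ.symm (φ g) :=
    (contMDiffOn_extChartAt_symm g).contMDiffAt (extChartAt_target_mem_nhds g)
  have hφg : φ.symm (φ g) = g := extChartAt_to_inv g
  have hΦ : ContDiffAt ℝ 2 (Function.uncurry fun (t : ℝ) (u : E) => f t (φ.symm u)) (0, φ g) := by
    have h1 : ContMDiffAt 𝓘(ℝ, ℝ × E) (𝓘(ℝ, ℝ).prod I) ∞ (fun z : ℝ × E => (z.1, φ.symm z.2))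
        (0, φ g) := by
      refine ContMDiffAt.prodMk contDiffAt_fst.contMDiffAt ?_
      exact ContMDiffAt.comp ((0 : ℝ), φ g) (g := φ.symm) (f := Prod.snd) hsymm
        contDiffAt_snd.contMDiffAt
    have h2 : ContMDiffAt 𝓘(ℝ, ℝ × E) 𝓘(ℝ, ℝ) ∞
        (fun z : ℝ × E => f z.1 (φ.symm z.2)) (0, φ g) :=
      ContMDiffAt.comp ((0 : ℝ), φ g) (g := Function.uncurry f)
        (f := fun z : ℝ × E => (z.1, φ.symm z.2)) (by rwa [hφg]) h1
    exact h2.contDiffAt.of_le (by norm_cast)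
  obtain ⟨hd, hder⟩ := hΦ.hasDerivAt_partial_fderiv ha
  have hm : MDifferentiableAt I 𝓘(ℝ, ℝ) (fun y => deriv (fun t => f t y) 0) g :=
    (HasFDerivAt.hasMFDerivAt_of_comp_extChartAt_symm (I := I) (g := g)
      (h := fun y => deriv (fun t => f t y) 0) hd.hasFDerivAt).mdifferentiableAt
  have hev : ∀ᶠ t in 𝓝 (0 : ℝ), MDifferentiableAt I 𝓘(ℝ, ℝ) (f t) g := by
    have ht : Tendsto (fun t : ℝ => (t, φ g)) (𝓝 0) (𝓝 (0, φ g)) :=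
      (continuous_id.prodMk continuous_const).tendsto' _ _ rfl
    have h1 := ht.eventually (hΦ.eventually (by simp))
    filter_upwards [h1] with t h
    have h2 : DifferentiableAt ℝ (fun u => f t (φ.symm u)) (φ g) :=
      (h.differentiableAt (by simp)).comp (φ g)
        (f := fun u : E => (t, u)) ((differentiableAt_const t).prodMk differentiableAt_id)
    exact (HasFDerivAt.hasMFDerivAt_of_comp_extChartAt_symm (I := I) (g := g) (h := f t)
      h2.hasFDerivAt).mdifferentiableAt
  refine ⟨hm, ?_⟩
  rw [hm.mfderiv_eq_fderiv_comp_extChartAt_symm,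
    hev.self_of_nhds.mfderiv_eq_fderiv_comp_extChartAt_symm]
  refine hder.congr_of_eventuallyEq ?_
  filter_upwards [hev] with t h
  rw [h.mfderiv_eq_fderiv_comp_extChartAt_symm]
  rfl

/-- The Lie bracket of vector fields is the commutator of the associated derivations. -/
theorem pointDeriv_mlieBracket [I.Boundaryless] [CompleteSpace E] {L : G → ℝ}
    (hL : ContMDiff I 𝓘(ℝ, ℝ) ∞ L) {V W : ∀ x : G, TangentSpace I x}
    (hV : ContMDiff I I.tangent ∞ (fun x => (⟨x, V x⟩ : TangentBundle I G)))
    (hW : ContMDiff I I.tangent ∞ (fun x => (⟨x, W x⟩ : TangentBundle I G))) (g : G) :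
    pointDeriv I L g (VectorField.mlieBracket I V W g) =
      pointDeriv I (fun y => pointDeriv I L y (W y)) g (V g) -
      pointDeriv I (fun y => pointDeriv I L y (V y)) g (W g) := by
  set φ := extChartAt I g
  have hφg : φ.symm (φ g) = g := extChartAt_to_inv g
  set L' : E → ℝ := L ∘ φ.symm with hL'
  have hsymm : ContMDiffOn 𝓘(ℝ, E) I ∞ φ.symm φ.target := contMDiffOn_extChartAt_symm g
  have htn : ∀ u ∈ φ.target, φ.target ∈ 𝓝 u := fun u hu => (isOpen_extChartAt_target g).mem_nhds hu
  have hu₀ : φ g ∈ φ.target := mem_extChartAt_target g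
  have hL'd : ContDiffAt ℝ 2 L' (φ g) := by
    have h1 : ContMDiffAt 𝓘(ℝ, E) 𝓘(ℝ, ℝ) ∞ L' (φ g) :=
      hL.contMDiffAt.comp (φ g) (hsymm.contMDiffAt (htn _ hu₀))
    exact h1.contDiffAt.of_le (by norm_cast)
  let pb : (∀ x : G, TangentSpace I x) → E → E := fun U =>
    VectorField.mpullbackWithin 𝓘(ℝ, E) I φ.symm U (range I)
  have hpbd : ∀ U : ∀ x : G, TangentSpace I x,
      ContMDiff I I.tangent ∞ (fun x => (⟨x, U x⟩ : TangentBundle I G)) →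
      DifferentiableAt ℝ (pb U) (φ g) := by
    intro U hU
    have h1 := (hU.contMDiffAt (x := g)).mdifferentiableAt (by simp)
    have h2 := (mdifferentiableWithinAt_univ.2
      h1).differentiableWithinAt_mpullbackWithin_vectorField
    have h3 : DifferentiableWithinAt ℝ (pb U) (φ.symm ⁻¹' univ ∩ range I) (φ g) := h2
    rwa [preimage_univ, univ_inter, I.range_eq_univ, differentiableWithinAt_univ] at h3
  have hpb0 : ∀ U : ∀ x : G, TangentSpace I x, pb U (φ g) = (U g : E) := by
    intro U
    have h1 : ∀ y : G, y = g → (U y : E) = U g := by rintro y rfl; rfl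
    have h2 := mfderivWithin_extChartAt_symm_inverse_apply (I := I) (x := g) (U (φ.symm (φ g)) : E)
    exact h2.trans (h1 _ hφg)
  -- The pull-back `pb U` is mapped back to `U` by the derivative of the inverse chart, so in the
  -- chart the function U(L) is the derivative of `L'` along `pb U`.
  have hpbL : ∀ U : ∀ x : G, TangentSpace I x, ∀ u ∈ φ.target,
      fderiv ℝ L' u (pb U u) = pointDeriv I L (φ.symm u) (U (φ.symm u)) := by
    intro U u hu
    have h1 : HasMFDerivAt 𝓘(ℝ, E) 𝓘(ℝ, ℝ) L' u _ :=
      HasMFDerivAt.comp u (hL.mdifferentiableAt (by simp)).hasMFDerivAt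
        ((hsymm.contMDiffAt (htn u hu)).mdifferentiableAt (by simp)).hasMFDerivAt
    have h2 := hasMFDerivAt_unique h1 (h1.mdifferentiableAt.differentiableAt.hasFDerivAt.hasMFDerivAt)
    have h3 := isInvertible_mfderivWithin_extChartAt_symm (I := I) hu
    have h4 : (mfderivWithin 𝓘(ℝ, E) I φ.symm (range I) u) (pb U u) = U (φ.symm u) :=
      h3.self_apply_inverse _
    rw [I.range_eq_univ, mfderivWithin_univ] at h4
    have h5 := DFunLike.congr_fun h2.symm (pb U u)
    refine h5.trans ?_
    exact congrArg (fun w : E => pointDeriv I L (φ.symm u) w) h4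
  -- W(U(L)) is a second derivative of `L'` plus a derivative of `pb U`. In the commutator the
  -- second derivatives cancel by symmetry and the remaining terms form the bracket.
  have hder : ∀ U W : ∀ x : G, TangentSpace I x,
      ContMDiff I I.tangent ∞ (fun x => (⟨x, U x⟩ : TangentBundle I G)) →
      pointDeriv I (fun y => pointDeriv I L y (U y)) g (W g) =
      fderiv ℝ (fderiv ℝ L') (φ g) (pb W (φ g)) (pb U (φ g)) +
        fderiv ℝ L' (φ g) (fderiv ℝ (pb U) (φ g) (pb W (φ g))) := by
    intro U W hU
    have h1 := ((ContMDiffAt.mfderiv_apply_section hL (hU.contMDiffAt (x := g))).mdifferentiableAt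
      (by simp)).hasMFDerivAt.hasFDerivAt_comp_extChartAt_symm
    have h2 : ((fun y => pointDeriv I L y (U y)) ∘ φ.symm) =ᶠ[𝓝 (φ g)]
        fun u => fderiv ℝ L' u (pb U u) := by
      filter_upwards [htn _ hu₀] with u hu using (hpbL U u hu).symm
    have h3 : HasFDerivAt (fun u => fderiv ℝ L' u (pb U u)) _ (φ g) :=
      ((hL'd.fderiv_right (m := 1) (by norm_num)).differentiableAt
        (by simp)).hasFDerivAt.clm_apply (hpbd U hU).hasFDerivAt
    have h4 : pointDeriv I (fun y => pointDeriv I L y (U y)) g = _ :=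
      h1.unique (h3.congr_of_eventuallyEq h2)
    have h5 : pointDeriv I (fun y => pointDeriv I L y (U y)) g (pb W (φ g)) =
        fderiv ℝ (fderiv ℝ L') (φ g) (pb W (φ g)) (pb U (φ g)) +
          fderiv ℝ L' (φ g) (fderiv ℝ (pb U) (φ g) (pb W (φ g))) := by
      rw [h4]
      simp [add_comm]
    exact (congrArg (fun w : E => pointDeriv I (fun y => pointDeriv I L y (U y)) g w)
      (hpb0 W).symm).trans h5
  have hbr : (VectorField.mlieBracket I V W g : E) =
      fderiv ℝ (pb W) (φ g) (pb V (φ g)) - fderiv ℝ (pb V) (φ g) (pb W (φ g)) := by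
    have h1 : (VectorField.mlieBracket I V W g : E) =
        (pointDeriv I φ g).inverse
          (VectorField.lieBracketWithin ℝ (E := E) (pb V) (pb W) (φ.symm ⁻¹' univ ∩ range I) (φ g)) := rfl
    have h2 : pointDeriv I φ g = ContinuousLinearMap.id ℝ E :=
      mfderiv_extChartAt_self
    rw [h1, h2, ContinuousLinearMap.inverse_id, preimage_univ, univ_inter,
      I.range_eq_univ, VectorField.lieBracketWithin_univ]
    rfl
  have hLg : pointDeriv I L g = fderiv ℝ L' (φ g) :=
    (hL.mdifferentiableAt (by simp)).mfderiv_eq_fderiv_comp_extChartAt_symm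
  have hs : IsSymmSndFDerivAt ℝ L' (φ g) := hL'd.isSymmSndFDerivAt (by simp)
  rw [hder W V hW, hder V W hV, hs.eq]
  rw [hLg]
  exact (congrArg (fun w : E => fderiv ℝ L' (φ g) w) hbr).trans (by rw [map_sub]; ring)

end ChartComputations

/-! ### Tangent vectors over a fixed base point -/

section TangentBundle

variable {E : Type*} [NormedAddCommGroup E] [NormedSpace ℝ E]
  {H : Type*} [TopologicalSpace H] {I : ModelWithCorners ℝ E H}
  {E' : Type*} [NormedAddCommGroup E'] [NormedSpace ℝ E']
  {H' : Type*} [TopologicalSpace H'] {J : ModelWithCorners ℝ E' H'}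
  {G : Type*} [TopologicalSpace G] [ChartedSpace H G] [IsManifold I ∞ G]
  {M : Type*} [TopologicalSpace M] [ChartedSpace H' M]

-- The vectors are compared in the model space `E`, so no transport along the equality of base
-- points appears.
omit [IsManifold I ∞ G] in
theorem TangentBundle.mk_eq_mk {x y : G} {v w : E} (h : x = y) (hv : v = w) :
    (⟨x, v⟩ : TangentBundle I G) = ⟨y, w⟩ := by
  subst h hv; rfl

/-- The vector part of a smooth family of tangent vectors is differentiable, as a map to the model
space, within a set on which the base point is constant. -/
theorem ContMDiffAt.mdifferentiableWithinAt_snd_of_proj_eq {V : M → TangentBundle I G} {x₀ : M}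
    (hV : ContMDiffAt J I.tangent ∞ V x₀) {S : Set M}
    (hS : ∀ᶠ x in 𝓝[S] x₀, (V x).proj = (V x₀).proj) :
    MDifferentiableWithinAt J 𝓘(ℝ, E) (fun x => ((V x).2 : E)) S x₀ := by
  have h1 := ((Bundle.contMDiffAt_totalSpace (f := V) (x₀ := x₀)).1 hV).2
  have h2 := (h1.mdifferentiableAt (by simp)).mdifferentiableWithinAt (s := S)
  have h3 : ∀ x, (V x).proj = (V x₀).proj →
      ((V x).2 : E) = (trivializationAt E (TangentSpace I) (V x₀).proj (V x)).2 := fun x hx =>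
    (TangentBundle.trivializationAt_self_snd (I := I) (V x₀).proj (V x).proj (V x).2 hx).symm
  exact h2.congr_of_eventuallyEq (hS.mono h3) (h3 x₀ rfl)

end TangentBundle

section Fibres

variable {E : Type*} [NormedAddCommGroup E] [NormedSpace ℝ E]
  {H : Type*} [TopologicalSpace H] {I : ModelWithCorners ℝ E H} [I.Boundaryless]
  {E' : Type*} [NormedAddCommGroup E'] [NormedSpace ℝ E']
  {H' : Type*} [TopologicalSpace H'] {J : ModelWithCorners ℝ E' H'}
  {G : Type*} [TopologicalSpace G] [ChartedSpace H G] [IsManifold I ∞ G]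
  {M : Type*} [TopologicalSpace M] [ChartedSpace H' M]
  {E'' : Type*} [NormedAddCommGroup E''] [NormedSpace ℝ E'']
  {H'' : Type*} [TopologicalSpace H''] {I'' : ModelWithCorners ℝ E'' H''}
  {N : Type*} [TopologicalSpace N] [ChartedSpace H'' N]

/-- The derivative of a map which is constant on a fibre vanishes on the vectors tangent to the
fibre. -/
theorem Manifold.IsSubmersionAt.fibre_derivative_eq_zero {s : G → M} {g : G}
    (h : Manifold.IsSubmersionAt I J ∞ s g) {f : G → N} {D : E →L[ℝ] E''}
    (hD : HasMFDerivWithinAt I I'' f {x | s x = s g} g D) (hf : ∀ x, s x = s g → f x = f g)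
    (w : TangentSpace I g) (hw : mfderiv I J s g w = 0) : D (w : E) = 0 := by
  have h0 : HasMFDerivWithinAt I I'' f {x | s x = s g} g (0 : E →L[ℝ] E'') :=
    (hasMFDerivWithinAt_const (f g) _ g).congr_mono hf rfl Subset.rfl
  exact h.fibre_derivative_unique hD h0 w hw

end Fibres

/-! ### Tangent calculus of the translations -/

namespace LieGroupoid

variable {E : Type*} [NormedAddCommGroup E] [NormedSpace ℝ E]
  {H : Type*} [TopologicalSpace H] {I : ModelWithCorners ℝ E H}
  {E' : Type*} [NormedAddCommGroup E'] [NormedSpace ℝ E']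
  {H' : Type*} [TopologicalSpace H'] {J : ModelWithCorners ℝ E' H'}
  {G : Type*} [TopologicalSpace G] [ChartedSpace H G]
  {M : Type*} [TopologicalSpace M] [ChartedSpace H' M]
  {E'' : Type*} [NormedAddCommGroup E''] [NormedSpace ℝ E'']
  {H'' : Type*} [TopologicalSpace H''] {I'' : ModelWithCorners ℝ E'' H''}
  {N : Type*} [TopologicalSpace N] [ChartedSpace H'' N]

/-! ### Groupoid algebra -/

theorem inv_one (𝒢 : LieGroupoid I J G M) (x : M) : 𝒢.inv (𝒢.one x) = 𝒢.one x := by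
  have h1 := 𝒢.mul_inv (𝒢.one x)
  have h2 := 𝒢.one_mul (𝒢.inv (𝒢.one x))
  rw [𝒢.src_inv, 𝒢.tgt_one] at h2
  rw [h2, 𝒢.src_one] at h1
  exact h1

theorem mul_inv_mul_cancel (𝒢 : LieGroupoid I J G M) {h g : G} (e : 𝒢.src h = 𝒢.src g) :
    𝒢.mul h (𝒢.mul (𝒢.inv h) g) = g := by
  rw [𝒢.mul_assoc _ _ _ (𝒢.src_inv h).symm (by rw [𝒢.tgt_inv, e]), 𝒢.mul_inv, e, 𝒢.one_mul]

theorem src_inv_mul (𝒢 : LieGroupoid I J G M) {h g : G} (e : 𝒢.src h = 𝒢.src g) :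
    𝒢.src (𝒢.mul (𝒢.inv h) g) = 𝒢.tgt h := by
  rw [𝒢.src_mul _ _ (by rw [𝒢.tgt_inv, e]), 𝒢.src_inv]

theorem tgt_inv_mul (𝒢 : LieGroupoid I J G M) {h g : G} (e : 𝒢.src h = 𝒢.src g) :
    𝒢.tgt (𝒢.mul (𝒢.inv h) g) = 𝒢.tgt g :=
  𝒢.tgt_mul _ _ (by rw [𝒢.tgt_inv, e])

theorem contMDiff_src (𝒢 : LieGroupoid I J G M) : ContMDiff I J ∞ 𝒢.src :=
  𝒢.isSubmersion_src.contMDiff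

theorem contMDiff_tgt (𝒢 : LieGroupoid I J G M) : ContMDiff I J ∞ 𝒢.tgt :=
  𝒢.isSubmersion_tgt.contMDiff

/-- Products of smooth maps with composable values are smooth. -/
theorem contMDiffAt_mul (𝒢 : LieGroupoid I J G M) {u v : N → G} {x : N}
    (hu : ContMDiffAt I'' I ∞ u x) (hv : ContMDiffAt I'' I ∞ v x)
    (huv : ∀ᶠ y in 𝓝 x, 𝒢.tgt (u y) = 𝒢.src (v y)) :
    ContMDiffAt I'' I ∞ (fun y => 𝒢.mul (u y) (v y)) x := by
  have h1 := 𝒢.contMDiffOn_mul (u x, v x) huv.self_of_nhds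
  have h2 : ContMDiffWithinAt I'' (I.prod I) ∞ (fun y => (u y, v y))
      {y | 𝒢.tgt (u y) = 𝒢.src (v y)} x := (hu.prodMk hv).contMDiffWithinAt
  have h3 : ContMDiffWithinAt I'' I ∞ (fun y => 𝒢.mul (u y) (v y))
      {y | 𝒢.tgt (u y) = 𝒢.src (v y)} x := h1.comp x h2 fun y hy => hy
  exact h3.contMDiffAt huv

/-! ### Tangent maps of translations -/

/-- Only a derivative within the β-fibre is available, since multiplication is smooth only on
composable pairs. The point `g` merely labels the target tangent space. -/
theorem hasMFDerivWithinAt_mul_right (𝒢 : LieGroupoid I J G M) {h k : G}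
    (e : 𝒢.tgt h = 𝒢.src k) (g : G) :
    HasMFDerivWithinAt I I (fun x => 𝒢.mul x k) {x | 𝒢.tgt x = 𝒢.tgt h} h
      (𝒢.tangentRight h k g : E →L[ℝ] E) := by
  have h1 : ContMDiffWithinAt I I ∞ (fun x => 𝒢.mul x k) {x | 𝒢.tgt x = 𝒢.tgt h} h := by
    refine (𝒢.contMDiffOn_mul (h, k) e).comp h (f := fun x => (x, k))
      (contMDiffWithinAt_id.prodMk contMDiffWithinAt_const) fun x hx => ?_
    exact Eq.trans hx e
  exact (h1.mdifferentiableWithinAt (by simp)).hasMFDerivWithinAt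

theorem hasMFDerivWithinAt_mul_left (𝒢 : LieGroupoid I J G M) {k h : G}
    (e : 𝒢.tgt k = 𝒢.src h) (g : G) :
    HasMFDerivWithinAt I I (fun x => 𝒢.mul k x) {x | 𝒢.src x = 𝒢.src h} h
      (𝒢.tangentLeft k h g : E →L[ℝ] E) := by
  have h1 : ContMDiffWithinAt I I ∞ (fun x => 𝒢.mul k x) {x | 𝒢.src x = 𝒢.src h} h := by
    refine (𝒢.contMDiffOn_mul (k, h) e).comp h (f := fun x => (k, x))
      (contMDiffWithinAt_const.prodMk contMDiffWithinAt_id) fun x hx => ?_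
    exact Eq.trans e (Eq.symm hx)
  exact (h1.mdifferentiableWithinAt (by simp)).hasMFDerivWithinAt

section

variable [I.Boundaryless] [IsManifold I ∞ G]

/-- Right translation by `k` has constant target β(k) on the β-fibre of `h`, so its composite with β
has zero derivative on tangent vectors. -/
theorem tangentRight_vertical (𝒢 : LieGroupoid I J G M) {h k g : G} (e : 𝒢.tgt h = 𝒢.src k)
    (hg : 𝒢.mul h k = g) (w : TangentSpace I h) (hw : mfderiv I J 𝒢.tgt h w = 0) :
    mfderiv I J 𝒢.tgt g (𝒢.tangentRight h k g w) = 0 := by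
  subst hg
  have h1 := 𝒢.hasMFDerivWithinAt_mul_right e (𝒢.mul h k)
  have h2 := ((𝒢.contMDiff_tgt.mdifferentiable (by simp)) (𝒢.mul h k)).hasMFDerivAt
  have h3 := h2.comp_hasMFDerivWithinAt h h1
  exact (𝒢.isSubmersion_tgt.isSubmersionAt h).fibre_derivative_eq_zero h3
    (fun x hx => by simp [𝒢.tgt_mul _ _ (hx.trans e), 𝒢.tgt_mul _ _ e]) w hw

theorem tangentLeft_vertical (𝒢 : LieGroupoid I J G M) {h k g : G} (e : 𝒢.tgt k = 𝒢.src h)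
    (hg : 𝒢.mul k h = g) (w : TangentSpace I h) (hw : mfderiv I J 𝒢.src h w = 0) :
    mfderiv I J 𝒢.src g (𝒢.tangentLeft k h g w) = 0 := by
  subst hg
  have h1 := 𝒢.hasMFDerivWithinAt_mul_left e (𝒢.mul k h)
  have h2 := ((𝒢.contMDiff_src.mdifferentiable (by simp)) (𝒢.mul k h)).hasMFDerivAt
  have h3 := h2.comp_hasMFDerivWithinAt h h1
  exact (𝒢.isSubmersion_src.isSubmersionAt h).fibre_derivative_eq_zero h3
    (fun x hx => by simp [𝒢.src_mul _ _ (e.trans hx.symm), 𝒢.src_mul _ _ e]) w hw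

/-- The derivative of associativity (xk)l = x(kl) in `x` along the β-fibre of `h`. -/
theorem tangentRight_tangentRight (𝒢 : LieGroupoid I J G M) {h k l : G} (e : 𝒢.tgt h = 𝒢.src k)
    (e' : 𝒢.tgt k = 𝒢.src l) {g : G} (hg : 𝒢.mul h k = g) (g' : G) (w : TangentSpace I h)
    (hw : mfderiv I J 𝒢.tgt h w = 0) :
    𝒢.tangentRight g l g' (𝒢.tangentRight h k g w) = 𝒢.tangentRight h (𝒢.mul k l) g' w := by
  subst hg
  have hk : 𝒢.tgt (𝒢.mul h k) = 𝒢.src l := by rw [𝒢.tgt_mul _ _ e, e']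
  have h1 := 𝒢.hasMFDerivWithinAt_mul_right e (𝒢.mul h k)
  have h2 := 𝒢.hasMFDerivWithinAt_mul_right hk g'
  have h3 := HasMFDerivWithinAt.comp h h2 h1 fun x hx => by
    simp [𝒢.tgt_mul _ _ (Eq.trans hx e), 𝒢.tgt_mul _ _ e]
  have h4 := 𝒢.hasMFDerivWithinAt_mul_right (h := h) (k := 𝒢.mul k l)
    (by rw [𝒢.src_mul _ _ e', e]) g'
  refine (𝒢.isSubmersion_tgt.isSubmersionAt h).fibre_derivative_unique h3
    (h4.congr_mono (fun x hx => ?_) ?_ Subset.rfl) w hw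
  · exact (𝒢.mul_assoc _ _ _ (Eq.trans hx e) e').symm
  · exact (𝒢.mul_assoc _ _ _ e e').symm

theorem tangentRight_one (𝒢 : LieGroupoid I J G M) {h : G} (g : G) (w : TangentSpace I h)
    (hw : mfderiv I J 𝒢.tgt h w = 0) :
    (𝒢.tangentRight h (𝒢.one (𝒢.tgt h)) g w : E) = w := by
  have h1 := 𝒢.hasMFDerivWithinAt_mul_right (h := h) (k := 𝒢.one (𝒢.tgt h)) (𝒢.src_one _).symm g
  have h2 : HasMFDerivWithinAt I I (fun x => 𝒢.mul x (𝒢.one (𝒢.tgt h))) {x | 𝒢.tgt x = 𝒢.tgt h} h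
      (ContinuousLinearMap.id ℝ E) := by
    refine (hasMFDerivWithinAt_id _ h).congr_mono (fun x hx => ?_) (𝒢.mul_one h) Subset.rfl
    have hx' : 𝒢.tgt x = 𝒢.tgt h := hx
    rw [← hx', 𝒢.mul_one, id]
  exact (𝒢.isSubmersion_tgt.isSubmersionAt h).fibre_derivative_unique h1 h2 w hw

end

end LieGroupoid

/-- A smooth family of maps consists of differentiable maps. -/
theorem ContMDiffAt.eventually_mdifferentiableAt_family {E : Type*} [NormedAddCommGroup E]
    [NormedSpace ℝ E] {H : Type*} [TopologicalSpace H] {I : ModelWithCorners ℝ E H}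
    {E' : Type*} [NormedAddCommGroup E'] [NormedSpace ℝ E']
    {H' : Type*} [TopologicalSpace H'] {J : ModelWithCorners ℝ E' H'}
    {G : Type*} [TopologicalSpace G] [ChartedSpace H G] [IsManifold I ∞ G]
    {M : Type*} [TopologicalSpace M] [ChartedSpace H' M] [IsManifold J ∞ M]
    {E'' : Type*} [NormedAddCommGroup E''] [NormedSpace ℝ E'']
    {H'' : Type*} [TopologicalSpace H''] {I'' : ModelWithCorners ℝ E'' H''}
    {N : Type*} [TopologicalSpace N] [ChartedSpace H'' N] [IsManifold I'' ∞ N]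
    {f : G → M → N} {b : G → M} {x₀ : G}
    (hf : ContMDiffAt (I.prod J) I'' ∞ (Function.uncurry f) (x₀, b x₀)) (hb : ContinuousAt b x₀) :
    ∀ᶠ x in 𝓝 x₀, MDifferentiableAt J I'' (f x) (b x) := by
  have h1 : ContMDiffAt (I.prod J) I'' 1 (Function.uncurry f) (x₀, b x₀) := hf.of_le (by simp)
  have h2 := (contMDiffAt_iff_contMDiffAt_nhds (by simp)).1 h1
  have h3 : Tendsto (fun x => (x, b x)) (𝓝 x₀) (𝓝 (x₀, b x₀)) :=
    continuousAt_id.prodMk hb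
  filter_upwards [h3.eventually h2] with x hx
  exact (hx.mdifferentiableAt (by simp)).comp (b x) (f := fun y => (x, y))
    (mdifferentiableAt_const.prodMk mdifferentiableAt_id)

/-! ### Smoothness of invariant vector fields and of translated sections -/

namespace LieGroupoid

variable {E : Type*} [NormedAddCommGroup E] [NormedSpace ℝ E]
  {H : Type*} [TopologicalSpace H] {I : ModelWithCorners ℝ E H} [I.Boundaryless]
  {E' : Type*} [NormedAddCommGroup E'] [NormedSpace ℝ E']
  {H' : Type*} [TopologicalSpace H'] {J : ModelWithCorners ℝ E' H'}
  {G : Type*} [TopologicalSpace G] [ChartedSpace H G] [IsManifold I ∞ G]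
  {M : Type*} [TopologicalSpace M] [ChartedSpace H' M]

/-- The left-invariant vector field of a smooth section of `AG` is smooth. -/
theorem IsAlgebroidSection.contMDiff_leftInvariant {𝒢 : LieGroupoid I J G M}
    {X : ∀ x : M, TangentSpace I (𝒢.one x)} (hX : 𝒢.IsAlgebroidSection X) :
    ContMDiff I I.tangent ∞ (fun g => (⟨g, 𝒢.leftInvariant X g⟩ : TangentBundle I G)) := by
  intro g₀
  obtain ⟨p, hp, hps, hpid⟩ :=
    (𝒢.isSubmersion_src.isSubmersionAt (𝒢.one (𝒢.tgt g₀))).exists_fibre_retraction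
  rw [𝒢.src_one] at hp hps
  -- Left translation by `g` is meaningful only on one α-fibre. Composing it with the retraction
  -- onto that fibre gives a family smooth near `(g₀, b g₀)` with the same derivative on vectors
  -- tangent to the fibre.
  let f : G → G → G := fun g h => 𝒢.mul g (p h (𝒢.tgt g))
  let b : G → G := fun g => 𝒢.one (𝒢.tgt g)
  have hb : ContMDiff I I ∞ b := 𝒢.contMDiff_one.comp 𝒢.contMDiff_tgt
  have hsnd : ContMDiffAt (I.prod I) (I.prod J) ∞ (fun z : G × G => (z.2, 𝒢.tgt z.1)) (g₀, b g₀) :=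
    contMDiffAt_snd.prodMk (𝒢.contMDiff_tgt.contMDiffAt.comp _ contMDiffAt_fst)
  have hf : ContMDiffAt (I.prod I) I ∞ (Function.uncurry f) (g₀, b g₀) := by
    refine 𝒢.contMDiffAt_mul contMDiffAt_fst
      (ContMDiffAt.comp (g₀, b g₀) (g := Function.uncurry p) hp hsnd) ?_
    filter_upwards [hsnd.continuousAt.eventually hps] with z hz using hz.symm
  have hv : ContMDiffAt I I.tangent ∞ (fun g => (⟨b g, X (𝒢.tgt g)⟩ : TangentBundle I G)) g₀ :=
    (hX.smooth.comp 𝒢.contMDiff_tgt).contMDiffAt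
  refine (ContMDiffAt.mfderiv_family_apply hf hv).congr_of_eventuallyEq ?_
  filter_upwards [hf.eventually_mdifferentiableAt_family hb.continuous.continuousAt,
    hb.continuous.continuousAt.eventually (eventually_eventually_nhds.2 hpid)] with g hg1 hg2
  have hsb : 𝒢.tgt g = 𝒢.src (b g) := (𝒢.src_one _).symm
  have h0 : f g (b g) = g := by
    have h3 : p (b g) (𝒢.src (b g)) = b g := hg2.self_of_nhds
    rw [𝒢.src_one] at h3
    change 𝒢.mul g (p (b g) (𝒢.tgt g)) = g
    rw [h3, 𝒢.mul_one]
  refine TangentBundle.mk_eq_mk h0.symm ?_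
  have h1 := 𝒢.hasMFDerivWithinAt_mul_left hsb g
  have h2 : HasMFDerivWithinAt I I (fun x => 𝒢.mul g x) {x | 𝒢.src x = 𝒢.src (b g)} (b g)
      (mfderiv I I (f g) (b g) : E →L[ℝ] E) := by
    have hev : ∀ᶠ x in 𝓝[{x | 𝒢.src x = 𝒢.src (b g)}] (b g), 𝒢.mul g x = f g x := by
      filter_upwards [nhdsWithin_le_nhds hg2, self_mem_nhdsWithin] with x hx hx'
      have hx'' : 𝒢.src x = 𝒢.tgt g := Eq.trans hx' hsb.symm
      rw [hx''] at hx
      exact congrArg (𝒢.mul g) hx.symm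
    refine hg1.hasMFDerivAt.hasMFDerivWithinAt.congr_of_eventuallyEq hev ?_
    exact (𝒢.mul_one g).trans h0.symm
  exact (𝒢.isSubmersion_src.isSubmersionAt (b g)).fibre_derivative_unique h1 h2 _
    (hX.vertical (𝒢.tgt g))

omit [I.Boundaryless] in
/-- The inversion maps the fibres `A_x G = ker T α` to `ker T β`. -/
theorem IsAlgebroidSection.mfderiv_tgt_mfderiv_inv {𝒢 : LieGroupoid I J G M}
    {X : ∀ x : M, TangentSpace I (𝒢.one x)} (hX : 𝒢.IsAlgebroidSection X) (x : M) :
    (mfderiv I J 𝒢.tgt (𝒢.one x) : E →L[ℝ] E')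
      (mfderiv I I 𝒢.inv (𝒢.one x) (X x) : E) = 0 := by
  have h1 := ((𝒢.contMDiff_inv.mdifferentiable (by simp)) (𝒢.one x)).hasMFDerivAt
  have h2 : HasMFDerivAt I J 𝒢.tgt (𝒢.inv (𝒢.one x))
      (mfderiv I J 𝒢.tgt (𝒢.one x) : E →L[ℝ] E') := by
    rw [𝒢.inv_one]
    exact ((𝒢.contMDiff_tgt.mdifferentiable (by simp)) (𝒢.one x)).hasMFDerivAt
  have h3 := HasMFDerivAt.comp (𝒢.one x) h2 h1
  -- Inversion fixes units and exchanges source and target, so this chain rule identifies Tβ(Ti X)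
  -- with Tα X, which is zero.
  have h4 : 𝒢.tgt ∘ 𝒢.inv = 𝒢.src := funext 𝒢.tgt_inv
  rw [h4] at h3
  have h5 := hasMFDerivAt_unique h3
    ((𝒢.contMDiff_src.mdifferentiable (by simp)) (𝒢.one x)).hasMFDerivAt
  exact (DFunLike.congr_fun h5 (X x)).trans (hX.vertical x)

omit [I.Boundaryless] in
/-- The field `x ↦ T i (X x)` along the identity section is smooth. -/
theorem IsAlgebroidSection.contMDiff_mfderiv_inv {𝒢 : LieGroupoid I J G M}
    {X : ∀ x : M, TangentSpace I (𝒢.one x)} (hX : 𝒢.IsAlgebroidSection X) :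
    ContMDiff J I.tangent ∞ (fun x => (⟨𝒢.one x,
      (mfderiv I I 𝒢.inv (𝒢.one x) (X x) : E)⟩ : TangentBundle I G)) := by
  have h1 := (𝒢.contMDiff_inv.contMDiff_tangentMap (m := ∞) (by simp)).comp hX.smooth
  refine h1.congr fun x => ?_
  exact TangentBundle.mk_eq_mk (𝒢.inv_one x).symm rfl

/-- The right-invariant vector field of a smooth section of `AG` is smooth. -/
theorem IsAlgebroidSection.contMDiff_rightInvariant {𝒢 : LieGroupoid I J G M}
    {X : ∀ x : M, TangentSpace I (𝒢.one x)} (hX : 𝒢.IsAlgebroidSection X) :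
    ContMDiff I I.tangent ∞ (fun g => (⟨g, 𝒢.rightInvariant X g⟩ : TangentBundle I G)) := by
  suffices h : ContMDiff I I.tangent ∞ (fun g => (⟨g,
      𝒢.tangentRight (𝒢.one (𝒢.src g)) g g
        (mfderiv I I 𝒢.inv (𝒢.one (𝒢.src g)) (X (𝒢.src g)) : E)⟩ : TangentBundle I G)) from
    h.neg_section
  intro g₀
  obtain ⟨p, hp, hps, hpid⟩ :=
    (𝒢.isSubmersion_tgt.isSubmersionAt (𝒢.one (𝒢.src g₀))).exists_fibre_retraction
  rw [𝒢.tgt_one] at hp hps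
  let f : G → G → G := fun g h => 𝒢.mul (p h (𝒢.src g)) g
  let b : G → G := fun g => 𝒢.one (𝒢.src g)
  have hb : ContMDiff I I ∞ b := 𝒢.contMDiff_one.comp 𝒢.contMDiff_src
  have hsnd : ContMDiffAt (I.prod I) (I.prod J) ∞ (fun z : G × G => (z.2, 𝒢.src z.1)) (g₀, b g₀) :=
    contMDiffAt_snd.prodMk (𝒢.contMDiff_src.contMDiffAt.comp _ contMDiffAt_fst)
  have hf : ContMDiffAt (I.prod I) I ∞ (Function.uncurry f) (g₀, b g₀) := by
    refine 𝒢.contMDiffAt_mul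
      (ContMDiffAt.comp (g₀, b g₀) (g := Function.uncurry p) hp hsnd) contMDiffAt_fst ?_
    filter_upwards [hsnd.continuousAt.eventually hps] with z hz using hz
  have hv : ContMDiffAt I I.tangent ∞ (fun g => (⟨b g,
      (mfderiv I I 𝒢.inv (𝒢.one (𝒢.src g)) (X (𝒢.src g)) : E)⟩ : TangentBundle I G)) g₀ :=
    (hX.contMDiff_mfderiv_inv.comp 𝒢.contMDiff_src).contMDiffAt
  refine (ContMDiffAt.mfderiv_family_apply hf hv).congr_of_eventuallyEq ?_
  filter_upwards [hf.eventually_mdifferentiableAt_family hb.continuous.continuousAt,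
    hb.continuous.continuousAt.eventually (eventually_eventually_nhds.2 hpid)] with g hg1 hg2
  have hsb : 𝒢.tgt (b g) = 𝒢.src g := 𝒢.tgt_one _
  have h0 : f g (b g) = g := by
    have h3 : p (b g) (𝒢.tgt (b g)) = b g := hg2.self_of_nhds
    rw [𝒢.tgt_one] at h3
    change 𝒢.mul (p (b g) (𝒢.src g)) g = g
    rw [h3, 𝒢.one_mul]
  refine TangentBundle.mk_eq_mk h0.symm ?_
  have h1 := 𝒢.hasMFDerivWithinAt_mul_right hsb g
  have h2 : HasMFDerivWithinAt I I (fun x => 𝒢.mul x g) {x | 𝒢.tgt x = 𝒢.tgt (b g)} (b g)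
      (mfderiv I I (f g) (b g) : E →L[ℝ] E) := by
    have hev : ∀ᶠ x in 𝓝[{x | 𝒢.tgt x = 𝒢.tgt (b g)}] (b g), 𝒢.mul x g = f g x := by
      filter_upwards [nhdsWithin_le_nhds hg2, self_mem_nhdsWithin] with x hx hx'
      have hx'' : 𝒢.tgt x = 𝒢.src g := Eq.trans hx' hsb
      rw [hx''] at hx
      exact congrArg (fun y => 𝒢.mul y g) hx.symm
    refine hg1.hasMFDerivAt.hasMFDerivWithinAt.congr_of_eventuallyEq hev ?_
    exact (𝒢.one_mul g).trans h0.symm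
  exact (𝒢.isSubmersion_tgt.isSubmersionAt (b g)).fibre_derivative_unique h1 h2 _
    (hX.mfderiv_tgt_mfderiv_inv (𝒢.src g))

theorem IsAlgebroidSection.leftInvariant_vertical {𝒢 : LieGroupoid I J G M}
    {X : ∀ x : M, TangentSpace I (𝒢.one x)} (hX : 𝒢.IsAlgebroidSection X) (g : G) :
    mfderiv I J 𝒢.src g (𝒢.leftInvariant X g) = 0 :=
  𝒢.tangentLeft_vertical (𝒢.src_one _).symm (𝒢.mul_one g) _ (hX.vertical _)

theorem IsAlgebroidSection.rightInvariant_vertical {𝒢 : LieGroupoid I J G M}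
    {X : ∀ x : M, TangentSpace I (𝒢.one x)} (hX : 𝒢.IsAlgebroidSection X) (g : G) :
    mfderiv I J 𝒢.tgt g (𝒢.rightInvariant X g) = 0 := by
  rw [rightInvariant, map_neg, neg_eq_zero]
  exact 𝒢.tangentRight_vertical (𝒢.tgt_one _) (𝒢.one_mul g) _ (hX.mfderiv_tgt_mfderiv_inv _)

/-- The complete lift of a smooth section of `AG` is a smooth section of `Vβ ⊕ Vα`. -/
theorem IsAlgebroidSection.isSection_completeLift {𝒢 : LieGroupoid I J G M}
    {X : ∀ x : M, TangentSpace I (𝒢.one x)} (hX : 𝒢.IsAlgebroidSection X) :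
    𝒢.IsSection (𝒢.completeLift X) where
  vertical_fst g := by
    rw [completeLift, map_neg, neg_eq_zero]
    exact hX.rightInvariant_vertical g
  vertical_snd g := hX.leftInvariant_vertical g
  smooth_fst := hX.contMDiff_rightInvariant.neg_section
  smooth_snd := hX.contMDiff_leftInvariant

/-- The function differentiated in `fiberDeriv` is differentiable on the `α`-fibre. -/
theorem mdifferentiableWithinAt_tangentRight_apply (𝒢 : LieGroupoid I J G M)
    {A : ∀ g : G, TangentSpace I g} (hAv : ∀ g, mfderiv I J 𝒢.tgt g (A g) = 0)
    (hA : ContMDiff I I.tangent ∞ (fun g => (⟨g, A g⟩ : TangentBundle I G))) (g : G) :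
    MDifferentiableWithinAt I 𝓘(ℝ, E) (M' := E)
      (fun h => (𝒢.tangentRight h (𝒢.mul (𝒢.inv h) g) g (A h) : E)) {h | 𝒢.src h = 𝒢.src g} g := by
  obtain ⟨p, hp, hps, hpid⟩ := (𝒢.isSubmersion_tgt.isSubmersionAt g).exists_fibre_retraction
  obtain ⟨q, hq, hqs, hqid⟩ := (𝒢.isSubmersion_src.isSubmersionAt g).exists_fibre_retraction
  have hqg : q g (𝒢.src g) = g := hqid.self_of_nhds
  let r : G → G := fun h => q h (𝒢.src g)
  have hr : ContMDiffAt I I ∞ r g :=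
    ContMDiffAt.comp g (g := Function.uncurry q) (f := fun h => (h, 𝒢.src g)) hq
      (contMDiffAt_id.prodMk contMDiffAt_const)
  have hrg : r g = g := hqg
  have hr1 : ContMDiffAt (I.prod I) I ∞ (fun z : G × G => r z.1) (g, g) :=
    ContMDiffAt.comp (g, g) (g := r) hr contMDiffAt_fst
  have hrs : ∀ᶠ h in 𝓝 g, 𝒢.src (r h) = 𝒢.src g := by
    have : Tendsto (fun h : G => (h, 𝒢.src g)) (𝓝 g) (𝓝 (g, 𝒢.src g)) :=
      continuousAt_id.prodMk continuousAt_const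
    exact this.eventually hqs
  -- For `h` near `g` on the α-fibre of `g`, `r h = h`, and for `x` near `h` on the β-fibre of `h`
  -- this is right translation `x h⁻¹ g`. The retractions `r` and `p` make the family smooth in all
  -- `(h, x)` near `(g, g)`.
  let κ : G → G → G := fun h x => 𝒢.mul (𝒢.mul (p x (𝒢.tgt (r h))) (𝒢.inv (r h))) g
  have hpair : ContMDiffAt (I.prod I) (I.prod J) ∞ (fun z : G × G => (z.2, 𝒢.tgt (r z.1)))
      (g, g) :=
    contMDiffAt_snd.prodMk (𝒢.contMDiff_tgt.contMDiffAt.comp _ hr1)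
  have hpair0 : ((g, g).2, 𝒢.tgt (r (g, g).1)) = (g, 𝒢.tgt g) := by simp [hrg]
  have hp1 : ContMDiffAt (I.prod I) I ∞ (fun z : G × G => p z.2 (𝒢.tgt (r z.1))) (g, g) :=
    ContMDiffAt.comp (g, g) (g := Function.uncurry p) (by rw [hpair0]; exact hp) hpair
  have hp2 : ∀ᶠ z : G × G in 𝓝 (g, g),
      𝒢.tgt (p z.2 (𝒢.tgt (r z.1))) = 𝒢.src (𝒢.inv (r z.1)) := by
    have h1 := hpair.continuousAt
    rw [ContinuousAt, hpair0] at h1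
    filter_upwards [h1.eventually hps] with z hz
    rw [𝒢.src_inv]; exact hz
  have hκ : ContMDiffAt (I.prod I) I ∞ (Function.uncurry κ) (g, g) := by
    refine 𝒢.contMDiffAt_mul (𝒢.contMDiffAt_mul hp1 (𝒢.contMDiff_inv.contMDiffAt.comp _ hr1) hp2)
      contMDiffAt_const ?_
    have h1 : ∀ᶠ z : G × G in 𝓝 (g, g), 𝒢.src (r z.1) = 𝒢.src g :=
      (continuous_fst.tendsto ((g, g) : G × G)).eventually hrs
    filter_upwards [hp2, h1] with z hz1 hz2
    rw [𝒢.tgt_mul _ _ hz1, 𝒢.tgt_inv, hz2]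
  have hV := ContMDiffAt.mfderiv_family_apply (b := id) (v := A) hκ hA.contMDiffAt
  have hev : ∀ᶠ h in 𝓝[{h | 𝒢.src h = 𝒢.src g}] g, κ h h = g ∧
      (𝒢.tangentRight h (𝒢.mul (𝒢.inv h) g) g (A h) : E) = mfderiv I I (κ h) h (A h) := by
    filter_upwards [nhdsWithin_le_nhds (eventually_eventually_nhds.2 hpid),
      nhdsWithin_le_nhds hqid, self_mem_nhdsWithin,
      nhdsWithin_le_nhds (hκ.eventually_mdifferentiableAt_family (b := id) continuousAt_id)]
      with h h1 h2 h3 h4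
    have h3' : 𝒢.src h = 𝒢.src g := h3
    have hrh : r h = h := by rw [h3'] at h2; exact h2
    have hκx : ∀ x, 𝒢.tgt x = 𝒢.tgt h → p x (𝒢.tgt x) = x →
        𝒢.mul x (𝒢.mul (𝒢.inv h) g) = κ h x := by
      intro x hx hpx
      change _ = 𝒢.mul (𝒢.mul (p x (𝒢.tgt (r h))) (𝒢.inv (r h))) g
      rw [hrh, ← hx, hpx, 𝒢.mul_assoc _ _ _ (hx.trans (𝒢.src_inv h).symm)
        ((𝒢.tgt_inv h).trans h3')]
    have hκh : κ h h = g := by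
      rw [← hκx h rfl h1.self_of_nhds, 𝒢.mul_inv_mul_cancel h3']
    refine ⟨hκh, ?_⟩
    have d1 := 𝒢.hasMFDerivWithinAt_mul_right (h := h) (k := 𝒢.mul (𝒢.inv h) g)
      (𝒢.src_inv_mul h3').symm g
    have d2 : HasMFDerivWithinAt I I (fun x => 𝒢.mul x (𝒢.mul (𝒢.inv h) g))
        {x | 𝒢.tgt x = 𝒢.tgt h} h (mfderiv I I (κ h) h : E →L[ℝ] E) := by
      refine h4.hasMFDerivAt.hasMFDerivWithinAt.congr_of_eventuallyEq ?_
        (hκx h rfl h1.self_of_nhds)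
      filter_upwards [nhdsWithin_le_nhds h1, self_mem_nhdsWithin] with x hx1 hx2
      exact hκx x hx2 hx1
    exact (𝒢.isSubmersion_tgt.isSubmersionAt h).fibre_derivative_unique d1 d2 _ (hAv h)
  have hg : g ∈ {h | 𝒢.src h = 𝒢.src g} := rfl
  have hκg := (hev.self_of_nhdsWithin hg).1
  -- Near `g` on the α-fibre the translated vectors all lie over `g`, so smoothness in the tangent
  -- bundle becomes differentiability in the fixed vector space.
  have h5 := hV.mdifferentiableWithinAt_snd_of_proj_eq (S := {h | 𝒢.src h = 𝒢.src g})
    (hev.mono fun h hh => hh.1.trans hκg.symm)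
  exact h5.congr_of_eventuallyEq (hev.mono fun h hh => hh.2) (hev.self_of_nhdsWithin hg).2

end LieGroupoid

theorem HasMFDerivAt.hasDerivAt_curve {V : Type*} [NormedAddCommGroup V] [NormedSpace ℝ V]
    {c : ℝ → V} {t : ℝ} {w : V} (h : HasMFDerivAt 𝓘(ℝ, ℝ) 𝓘(ℝ, V) c t
      (ContinuousLinearMap.toSpanSingleton ℝ w : ℝ →L[ℝ] V)) : HasDerivAt c w t :=
  hasDerivAt_iff_hasFDerivAt.2 h.hasFDerivAt

/-- The velocity of a curve in the kernel of a continuous linear map lies in that kernel. -/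
theorem HasDerivAt.map_eq_zero {V W : Type*} [NormedAddCommGroup V] [NormedSpace ℝ V]
    [NormedAddCommGroup W] [NormedSpace ℝ W] {T : V →L[ℝ] W} {a : ℝ → V} {a' : V} {t : ℝ}
    (ha : HasDerivAt a a' t) (h : ∀ t, T (a t) = 0) : T a' = 0 := by
  have h1 := T.hasFDerivAt.comp_hasDerivAt t ha
  have h2 : HasDerivAt (T ∘ a) 0 t := by
    have h3 : T ∘ a = fun _ => 0 := funext h
    rw [h3]
    exact hasDerivAt_const _ _
  exact h1.unique h2

namespace LieGroupoid

variable {E : Type*} [NormedAddCommGroup E] [NormedSpace ℝ E]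
  {H : Type*} [TopologicalSpace H] {I : ModelWithCorners ℝ E H} [I.Boundaryless]
  {E' : Type*} [NormedAddCommGroup E'] [NormedSpace ℝ E']
  {H' : Type*} [TopologicalSpace H'] {J : ModelWithCorners ℝ E' H'}
  {G : Type*} [TopologicalSpace G] [ChartedSpace H G] [IsManifold I ∞ G]
  {M : Type*} [TopologicalSpace M] [ChartedSpace H' M]

/-! ### The partial connection `fiberDeriv` -/

/-- `fiberDeriv` vanishes on right-invariant vector fields. -/
theorem IsAlgebroidSection.fiberDeriv_neg_rightInvariant {𝒢 : LieGroupoid I J G M}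
    {X : ∀ x : M, TangentSpace I (𝒢.one x)} (hX : 𝒢.IsAlgebroidSection X)
    (B : ∀ g : G, TangentSpace I g) (g : G) :
    𝒢.fiberDeriv B (fun h => -𝒢.rightInvariant X h) g = 0 := by
  have hconst : ∀ h, 𝒢.src h = 𝒢.src g →
      (𝒢.tangentRight h (𝒢.mul (𝒢.inv h) g) g (-𝒢.rightInvariant X h) : E) =
        𝒢.tangentRight (𝒢.one (𝒢.src g)) g g
          (mfderiv I I 𝒢.inv (𝒢.one (𝒢.src g)) (X (𝒢.src g)) : E) := by
    intro h hh
    have h1 := 𝒢.tangentRight_tangentRight (h := 𝒢.one (𝒢.src h)) (k := h)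
      (l := 𝒢.mul (𝒢.inv h) g) (𝒢.tgt_one _) (𝒢.src_inv_mul hh).symm (𝒢.one_mul h) g
      (mfderiv I I 𝒢.inv (𝒢.one (𝒢.src h)) (X (𝒢.src h)) : E) (hX.mfderiv_tgt_mfderiv_inv _)
    rw [𝒢.mul_inv_mul_cancel hh] at h1
    -- The type of `X x` depends on `x`; the base point is generalized so that the equality of
    -- sources can be substituted.
    have h2 : ∀ x y : M, x = y →
        (𝒢.tangentRight (𝒢.one x) g g (mfderiv I I 𝒢.inv (𝒢.one x) (X x) : E) : E) =
          𝒢.tangentRight (𝒢.one y) g g (mfderiv I I 𝒢.inv (𝒢.one y) (X y) : E) := by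
      rintro x _ rfl; rfl
    refine Eq.trans ?_ (h1.trans (h2 _ _ hh))
    rw [rightInvariant, neg_neg]
  have h0 : HasMFDerivWithinAt I 𝓘(ℝ, E) (M' := E)
      (fun h => (𝒢.tangentRight h (𝒢.mul (𝒢.inv h) g) g (-𝒢.rightInvariant X h) : E))
      {h | 𝒢.src h = 𝒢.src g} g (0 : E →L[ℝ] E) :=
    (hasMFDerivWithinAt_const _ _ g).congr_mono (fun h hh => hconst h hh) (hconst g rfl) Subset.rfl
  -- `mfderivWithin` is zero by convention whenever zero is an admissible derivative, so this covers
  -- every `B`, vertical or not.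
  exact DFunLike.congr_fun h0.mfderivWithin_eq_zero (B g : E)

/-- `fiberDeriv` is the derivative along any curve in the `α`-fibre with the given velocity. -/
theorem hasDerivAt_tangentRight_curve (𝒢 : LieGroupoid I J G M)
    {A : ∀ g : G, TangentSpace I g} (hAv : ∀ g, mfderiv I J 𝒢.tgt g (A g) = 0)
    (hA : ContMDiff I I.tangent ∞ (fun g => (⟨g, A g⟩ : TangentBundle I G)))
    (B : ∀ g : G, TangentSpace I g) {g : G} {c : ℝ → G} (hc0 : c 0 = g)
    (hcs : ∀ t, 𝒢.src (c t) = 𝒢.src g)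
    (hc : HasMFDerivAt 𝓘(ℝ, ℝ) I c 0
      (ContinuousLinearMap.toSpanSingleton ℝ (B g : E) : ℝ →L[ℝ] E)) :
    HasDerivAt (F := E) (fun t => (𝒢.tangentRight (c t) (𝒢.mul (𝒢.inv (c t)) g) g (A (c t)) : E))
      (𝒢.fiberDeriv B A g : E) 0 := by
  have h1 := (𝒢.mdifferentiableWithinAt_tangentRight_apply hAv hA g).hasMFDerivWithinAt
  have h2 := h1.comp_curve hc hc0 hcs
  exact h2.hasDerivAt_curve

/-- `fiberDeriv` is additive in the differentiated section. -/
theorem fiberDeriv_sub (𝒢 : LieGroupoid I J G M) {A₁ A₂ : ∀ g : G, TangentSpace I g}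
    (hv₁ : ∀ g, mfderiv I J 𝒢.tgt g (A₁ g) = 0)
    (hA₁ : ContMDiff I I.tangent ∞ (fun g => (⟨g, A₁ g⟩ : TangentBundle I G)))
    (hv₂ : ∀ g, mfderiv I J 𝒢.tgt g (A₂ g) = 0)
    (hA₂ : ContMDiff I I.tangent ∞ (fun g => (⟨g, A₂ g⟩ : TangentBundle I G)))
    (B : ∀ g : G, TangentSpace I g) {g : G} (hB : mfderiv I J 𝒢.src g (B g) = 0) :
    𝒢.fiberDeriv B (A₁ - A₂) g = 𝒢.fiberDeriv B A₁ g - 𝒢.fiberDeriv B A₂ g := by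
  -- The chosen derivative within a fibre need not be additive in the function, as it is not unique.
  -- Ordinary derivatives along a curve with velocity `B g` are, and they compute `fiberDeriv`.
  obtain ⟨c, hc0, -, hcd, hcs⟩ :=
    (𝒢.isSubmersion_src.isSubmersionAt g).exists_curve_in_fibre (B g) hB
  have h1 := 𝒢.hasDerivAt_tangentRight_curve hv₁ hA₁ B hc0 hcs hcd
  have h2 := 𝒢.hasDerivAt_tangentRight_curve hv₂ hA₂ B hc0 hcs hcd
  have h3 := 𝒢.hasDerivAt_tangentRight_curve (A := A₁ - A₂)
    (fun g => by rw [Pi.sub_apply, map_sub, hv₁, hv₂, sub_zero]) (hA₁.sub_section hA₂) B hc0 hcs hcd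
  refine HasDerivAt.unique (F := E) h3 ((HasDerivAt.sub (F := E) h1 h2).congr_of_eventuallyEq
    (Eventually.of_forall fun t => ?_))
  exact map_sub (𝒢.tangentRight (c t) (𝒢.mul (𝒢.inv (c t)) g) g) (A₁ (c t)) (A₂ (c t))

/-- `fiberDeriv` along a left-invariant vector field is the Lie derivative: both sides act in the
same way on functions. -/
theorem IsAlgebroidSection.pointDeriv_fiberDeriv_leftInvariant {𝒢 : LieGroupoid I J G M}
    {X : ∀ x : M, TangentSpace I (𝒢.one x)} (hX : 𝒢.IsAlgebroidSection X)
    {A : ∀ g : G, TangentSpace I g} (hAv : ∀ g, mfderiv I J 𝒢.tgt g (A g) = 0)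
    (hA : ContMDiff I I.tangent ∞ (fun g => (⟨g, A g⟩ : TangentBundle I G)))
    {L : G → ℝ} (hL : ContMDiff I 𝓘(ℝ, ℝ) ∞ L) (g : G) :
    pointDeriv I L g (𝒢.fiberDeriv (𝒢.leftInvariant X) A g) =
      pointDeriv I (fun y => pointDeriv I L y (A y)) g (𝒢.leftInvariant X g) -
      pointDeriv I (fun y => pointDeriv I L y (𝒢.leftInvariant X y)) g (A g) := by
  have hsub := 𝒢.isSubmersion_tgt.isSubmersionAt g
  have hLd : ∀ y, HasMFDerivAt I 𝓘(ℝ, ℝ) L y (pointDeriv I L y) := fun y =>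
    ((hL.mdifferentiable (by simp)) y).hasMFDerivAt
  obtain ⟨p, hp, hps, hpid⟩ := hsub.exists_fibre_retraction
  obtain ⟨c, hc0, hcsm, hcd, hcs⟩ := (𝒢.isSubmersion_src.isSubmersionAt
    (𝒢.one (𝒢.tgt g))).exists_curve_in_fibre (X (𝒢.tgt g)) (hX.vertical _)
  have hcs' : ∀ t, 𝒢.src (c t) = 𝒢.tgt g := fun t => (hcs t).trans (𝒢.src_one _)
  have hps' : ∀ᶠ x in 𝓝 g, 𝒢.tgt (p x (𝒢.tgt g)) = 𝒢.tgt g := by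
    have : Tendsto (fun x : G => (x, 𝒢.tgt g)) (𝓝 g) (𝓝 (g, 𝒢.tgt g)) :=
      continuousAt_id.prodMk continuousAt_const
    exact this.eventually hps
  have hpsm : ContMDiffAt I I ∞ (fun x => p x (𝒢.tgt g)) g :=
    ContMDiffAt.comp g (g := Function.uncurry p) (f := fun x => (x, 𝒢.tgt g)) hp
      (contMDiffAt_id.prodMk contMDiffAt_const)
  have hpg : p g (𝒢.tgt g) = g := hpid.self_of_nhds
  -- velocities of the translated curves
  have hmulc : ∀ y, 𝒢.tgt y = 𝒢.tgt g → 𝒢.mul y (c 0) = y := by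
    intro y hy
    rw [hc0, ← hy, 𝒢.mul_one]
  have hvel : ∀ y, 𝒢.tgt y = 𝒢.tgt g → HasMFDerivAt 𝓘(ℝ, ℝ) I (fun t => 𝒢.mul y (c t)) 0
      (ContinuousLinearMap.toSpanSingleton ℝ (𝒢.leftInvariant X y : E) : ℝ →L[ℝ] E) := by
    intro y hy
    have h1 := 𝒢.hasMFDerivWithinAt_mul_left (k := y) (h := 𝒢.one (𝒢.tgt g))
      (hy.trans (𝒢.src_one _).symm) y
    have h2 := h1.comp_curve hcd hc0 hcs
    have h3 : ∀ x, x = 𝒢.tgt g → (𝒢.tangentLeft y (𝒢.one x) y (X x) : E) =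
        𝒢.tangentLeft y (𝒢.one (𝒢.tgt g)) y (X (𝒢.tgt g)) := by
      rintro x rfl; rfl
    have h4 : (𝒢.leftInvariant X y : E) =
        𝒢.tangentLeft y (𝒢.one (𝒢.tgt g)) y (X (𝒢.tgt g)) := h3 _ hy
    rw [h4]
    exact h2
  let h : ℝ → G := fun t => 𝒢.mul g (c t)
  have hh0 : h 0 = g := hmulc g rfl
  have hhs : ∀ t, 𝒢.src (h t) = 𝒢.src g := fun t => 𝒢.src_mul _ _ (hcs' t).symm
  have hht : ∀ t, 𝒢.tgt (h t) = 𝒢.tgt (c t) := fun t => 𝒢.tgt_mul _ _ (hcs' t).symm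
  -- `a t` is `A (h t)` carried back to the tangent space at `g`. As h(t)⁻¹g is inverse to c(t),
  -- right translation by `c t` restores `A (h t)`.
  let a : ℝ → E := fun t => 𝒢.tangentRight (h t) (𝒢.mul (𝒢.inv (h t)) g) g (A (h t))
  have ha : HasDerivAt a (𝒢.fiberDeriv (𝒢.leftInvariant X) A g : E) 0 :=
    𝒢.hasDerivAt_tangentRight_curve hAv hA _ hh0 hhs (hvel g rfl)
  have hav : ∀ t, (mfderiv I J 𝒢.tgt g : E →L[ℝ] E') (a t) = 0 := fun t =>
    𝒢.tangentRight_vertical (𝒢.src_inv_mul (hhs t)).symm (𝒢.mul_inv_mul_cancel (hhs t)) _ (hAv _)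
  have ha0 : a 0 = (A g : E) := by
    have h1 : ∀ y, y = g → (𝒢.tangentRight y (𝒢.mul (𝒢.inv y) g) g (A y) : E) = A g := by
      rintro y rfl
      rw [𝒢.inv_mul]
      exact 𝒢.tangentRight_one y (A y) (hAv y)
    exact h1 _ hh0
  -- `f 0` agrees with `L` only on the β-fibre, so replacing one by the other below requires the
  -- velocity of `a` to be tangent to it.
  have hav' : (mfderiv I J 𝒢.tgt g : E →L[ℝ] E')
      (𝒢.fiberDeriv (𝒢.leftInvariant X) A g : E) = 0 :=
    HasDerivAt.map_eq_zero (V := E) (W := E') ha hav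
  -- the function of two variables
  let f : ℝ → G → ℝ := fun t x => L (𝒢.mul (p x (𝒢.tgt g)) (c t))
  have hf : ContMDiffAt (𝓘(ℝ, ℝ).prod I) 𝓘(ℝ, ℝ) ∞ (Function.uncurry f) (0, g) := by
    have h1 : ContMDiffAt (𝓘(ℝ, ℝ).prod I) I ∞
        (fun z : ℝ × G => 𝒢.mul (p z.2 (𝒢.tgt g)) (c z.1)) (0, g) := by
      refine 𝒢.contMDiffAt_mul
        (ContMDiffAt.comp ((0 : ℝ), g) (g := fun x => p x (𝒢.tgt g)) hpsm contMDiffAt_snd)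
        (ContMDiffAt.comp ((0 : ℝ), g) (g := c) hcsm contMDiffAt_fst) ?_
      filter_upwards [(continuous_snd.tendsto ((0 : ℝ), g)).eventually hps'] with z hz
      rw [hcs']; exact hz
    exact hL.contMDiffAt.comp _ h1
  have hfd : ∀ t, HasMFDerivAt I 𝓘(ℝ, ℝ) (f t) g (pointDeriv I (f t) g) := by
    intro t
    have h1 : ContMDiffAt I I ∞ (fun x => 𝒢.mul (p x (𝒢.tgt g)) (c t)) g := by
      refine 𝒢.contMDiffAt_mul hpsm contMDiffAt_const ?_
      filter_upwards [hps'] with x hx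
      rw [hcs']; exact hx
    have h2 : ContMDiffAt I 𝓘(ℝ, ℝ) ∞ (f t) g := hL.contMDiffAt.comp g h1
    exact (h2.mdifferentiableAt (by simp)).hasMFDerivAt
  have hpx : ∀ᶠ x in 𝓝[{x | 𝒢.tgt x = 𝒢.tgt g}] g, p x (𝒢.tgt g) = x := by
    filter_upwards [nhdsWithin_le_nhds hpid, self_mem_nhdsWithin] with x hx1 hx2
    have hx2' : 𝒢.tgt x = 𝒢.tgt g := hx2
    rwa [hx2'] at hx1
  have hfL : ∀ t (w : E), (mfderiv I J 𝒢.tgt g : E →L[ℝ] E') w = 0 →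
      pointDeriv I (f t) g w = pointDeriv I L (h t) (𝒢.tangentRight g (c t) (h t) w : E) := by
    intro t w hw
    have h1 := 𝒢.hasMFDerivWithinAt_mul_right (h := g) (k := c t) (hcs' t).symm (h t)
    have h2 : HasMFDerivWithinAt I 𝓘(ℝ, ℝ) (fun x => L (𝒢.mul x (c t)))
        {x | 𝒢.tgt x = 𝒢.tgt g} g _ := (hLd (h t)).comp_hasMFDerivWithinAt g h1
    have h3 : HasMFDerivWithinAt I 𝓘(ℝ, ℝ) (fun x => L (𝒢.mul x (c t)))
        {x | 𝒢.tgt x = 𝒢.tgt g} g (pointDeriv I (f t) g) := by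
      refine (hfd t).hasMFDerivWithinAt.congr_of_eventuallyEq ?_ ?_
      · filter_upwards [hpx] with x hx
        simp only [f, hx]
      · simp only [f, hpg]
    exact hsub.fibre_derivative_unique h3 h2 w hw
  obtain ⟨hmd, hder⟩ := hf.hasDerivAt_partial_mfderiv ha
  have e1 : ∀ t, pointDeriv I (f t) g (a t) = pointDeriv I L (h t) (A (h t)) := by
    intro t
    rw [hfL t _ (hav t)]
    have h1 := 𝒢.tangentRight_tangentRight (h := h t) (k := 𝒢.mul (𝒢.inv (h t)) g) (l := c t)
      (𝒢.src_inv_mul (hhs t)).symm ((𝒢.tgt_inv_mul (hhs t)).trans (hcs' t).symm)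
      (𝒢.mul_inv_mul_cancel (hhs t)) (h t) (A (h t)) (hAv _)
    have h2 : 𝒢.mul (𝒢.mul (𝒢.inv (h t)) g) (c t) = 𝒢.one (𝒢.tgt (h t)) := by
      rw [← 𝒢.mul_assoc _ _ _ ((𝒢.tgt_inv _).trans (hhs t)) (hcs' t).symm]
      exact 𝒢.inv_mul (h t)
    rw [h2] at h1
    exact congrArg (fun w : E => pointDeriv I L (h t) w)
      (h1.trans (𝒢.tangentRight_one (h t) (A (h t)) (hAv _)))
  have e2 : pointDeriv I (f 0) g (𝒢.fiberDeriv (𝒢.leftInvariant X) A g) =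
      pointDeriv I L g (𝒢.fiberDeriv (𝒢.leftInvariant X) A g) := by
    have h1 : ∀ x ∈ {x | 𝒢.tgt x = 𝒢.tgt g}, L x = L (𝒢.mul x (c 0)) := fun x hx => by
      rw [hmulc x hx]
    have h3 : HasMFDerivWithinAt I 𝓘(ℝ, ℝ) L
        {x | 𝒢.tgt x = 𝒢.tgt g} g (pointDeriv I (f 0) g) := by
      refine (hfd 0).hasMFDerivWithinAt.congr_of_eventuallyEq ?_ ?_
      · filter_upwards [hpx, self_mem_nhdsWithin] with x hx hx'
        simp only [f, hx, h1 x hx']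
      · simp only [f, hpg, hmulc g rfl]
    exact hsub.fibre_derivative_unique h3 (hLd g).hasMFDerivWithinAt _ hav'
  have hBL : MDifferentiableAt I 𝓘(ℝ, ℝ)
      (fun y => pointDeriv I L y (𝒢.leftInvariant X y)) g :=
    (ContMDiffAt.mfderiv_apply_section hL hX.contMDiff_leftInvariant.contMDiffAt).mdifferentiableAt
      (by simp)
  -- On the β-fibre of `g`, the curve t ↦ y c(t) has velocity X←(y), so the `t`-derivative of `f` at
  -- 0 is X←(L). This suffices since `A g` is tangent to that fibre.
  have e3 : pointDeriv I (fun y => deriv (fun t => f t y) 0) g (A g) =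
      pointDeriv I (fun y => pointDeriv I L y (𝒢.leftInvariant X y)) g (A g) := by
    have h1 : ∀ y, 𝒢.tgt y = 𝒢.tgt g → p y (𝒢.tgt g) = y →
        pointDeriv I L y (𝒢.leftInvariant X y) = deriv (fun t => f t y) 0 := by
      intro y hy hpy
      have h2 := (hLd y).comp_curve (hvel y hy) (hmulc y hy)
      have h3 := h2.hasDerivAt_curve.deriv
      simp only [f, hpy]
      exact h3.symm
    have h2 : HasMFDerivWithinAt I 𝓘(ℝ, ℝ) (fun y => pointDeriv I L y (𝒢.leftInvariant X y))
        {x | 𝒢.tgt x = 𝒢.tgt g} g (pointDeriv I (fun y => deriv (fun t => f t y) 0) g) := by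
      refine hmd.hasMFDerivAt.hasMFDerivWithinAt.congr_of_eventuallyEq ?_ (h1 g rfl hpg)
      filter_upwards [hpx, self_mem_nhdsWithin] with x hx hx'
      exact h1 x hx' hx
    exact hsub.fibre_derivative_unique h2 hBL.hasMFDerivAt.hasMFDerivWithinAt (A g) (hAv g)
  have hAL : HasMFDerivAt I 𝓘(ℝ, ℝ) (fun y => pointDeriv I L y (A y)) g
      (pointDeriv I (fun y => pointDeriv I L y (A y)) g) :=
    ((ContMDiffAt.mfderiv_apply_section hL hA.contMDiffAt).mdifferentiableAt
      (by simp)).hasMFDerivAt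
  -- The derivative of t ↦ A(L)(h(t)) at 0 is computed twice: by the chain rule it is X←(A(L)), and
  -- by the product rule for `f` and `a` it is A(X←(L)) + (∇A)(L).
  have e4 := hAL.comp_curve (hvel g rfl) hh0
  have e5 := e4.hasDerivAt_curve
  have e6 := e5.unique (hder.congr_of_eventuallyEq (Eventually.of_forall fun t => (e1 t).symm))
  rw [ha0, e2, e3] at e6
  exact eq_sub_of_add_eq' e6.symm

end LieGroupoid

/-! ### Noether symmetries and Hamiltonian sections -/

namespace LieGroupoid

section

variable {E : Type*} [NormedAddCommGroup E] [NormedSpace ℝ E]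
  {H : Type*} [TopologicalSpace H] {I : ModelWithCorners ℝ E H} [I.Boundaryless]
  {E' : Type*} [NormedAddCommGroup E'] [NormedSpace ℝ E']
  {H' : Type*} [TopologicalSpace H'] {J : ModelWithCorners ℝ E' H'}
  {G : Type*} [TopologicalSpace G] [ChartedSpace H G] [IsManifold I ∞ G]
  {M : Type*} [TopologicalSpace M] [ChartedSpace H' M]

omit [I.Boundaryless] [IsManifold I ∞ G] in
theorem pointDeriv_map_add (φ : G → ℝ) (g : G) (v w : TangentSpace I g) :
    pointDeriv I φ g (v + w : TangentSpace I g) = pointDeriv I φ g v + pointDeriv I φ g w :=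
  map_add (pointDeriv I φ g) (v : E) (w : E)

omit [I.Boundaryless] [IsManifold I ∞ G] in
theorem pointDeriv_map_sub (φ : G → ℝ) (g : G) (v w : TangentSpace I g) :
    pointDeriv I φ g (v - w : TangentSpace I g) = pointDeriv I φ g v - pointDeriv I φ g w :=
  map_sub (pointDeriv I φ g) (v : E) (w : E)

omit [I.Boundaryless] [IsManifold I ∞ G] in
theorem pointDeriv_sub {φ ψ : G → ℝ} {g : G} (hφ : MDifferentiableAt I 𝓘(ℝ, ℝ) φ g)
    (hψ : MDifferentiableAt I 𝓘(ℝ, ℝ) ψ g) :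
    pointDeriv I (fun x => φ x - ψ x) g = pointDeriv I φ g - pointDeriv I ψ g :=
  (hφ.hasMFDerivAt.sub hψ.hasMFDerivAt).mfderiv

omit [I.Boundaryless] [IsManifold I ∞ G] in
theorem d₀_eq_pointDeriv (φ : G → ℝ) (Z : PairField I G) (g : G) :
    d₀ φ Z g = pointDeriv I φ g (Z.1 g) + pointDeriv I φ g (Z.2 g) :=
  pointDeriv_map_add φ g (Z.1 g) (Z.2 g)

omit [I.Boundaryless] [IsManifold I ∞ G] in
theorem d₀_sub {φ ψ : G → ℝ} {g : G} (hφ : MDifferentiableAt I 𝓘(ℝ, ℝ) φ g)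
    (hψ : MDifferentiableAt I 𝓘(ℝ, ℝ) ψ g) (Z : PairField I G) :
    d₀ (fun x => φ x - ψ x) Z g = d₀ φ Z g - d₀ ψ Z g := by
  simp only [d₀_eq_pointDeriv, pointDeriv_sub hφ hψ]
  have h : ∀ v : E, (pointDeriv I φ g - pointDeriv I ψ g) v =
    pointDeriv I φ g v - pointDeriv I ψ g v := fun v => rfl
  rw [h (Z.1 g), h (Z.2 g)]
  ring

omit [I.Boundaryless] in
theorem IsSection.contMDiff_thetaMinus {𝒢 : LieGroupoid I J G M} {Z : PairField I G}
    (hZ : 𝒢.IsSection Z) {L : G → ℝ} (hL : ContMDiff I 𝓘(ℝ, ℝ) ∞ L) :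
    ContMDiff I 𝓘(ℝ, ℝ) ∞ (thetaMinus L Z) := fun g =>
  (ContMDiffAt.mfderiv_apply_section hL (hZ.smooth_fst g)).neg

omit [I.Boundaryless] in
theorem IsSection.sub {𝒢 : LieGroupoid I J G M} {Z W : PairField I G}
    (hZ : 𝒢.IsSection Z) (hW : 𝒢.IsSection W) : 𝒢.IsSection (Z - W) where
  vertical_fst g := by
    rw [Prod.fst_sub, Pi.sub_apply, map_sub, hZ.vertical_fst, hW.vertical_fst, sub_zero]
  vertical_snd g := by
    rw [Prod.snd_sub, Pi.sub_apply, map_sub, hZ.vertical_snd, hW.vertical_snd, sub_zero]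
  smooth_fst := hZ.smooth_fst.sub_section hW.smooth_fst
  smooth_snd := hZ.smooth_snd.sub_section hW.smooth_snd

omit [I.Boundaryless] [IsManifold I ∞ G] in
/-- `(ℒ_Z Θ)(W) = ρ(Z)(Θ(W)) - Θ([Z, W])`. -/
theorem lieDeriv_eq (𝒢 : LieGroupoid I J G M) (μ : PairField I G → G → ℝ) (Z W : PairField I G)
    (g : G) : 𝒢.lieDeriv Z μ W g = d₀ (μ W) Z g - μ (𝒢.bracket Z W) g := by
  rw [lieDeriv, d₁]; ring

omit [I.Boundaryless] [IsManifold I ∞ G] in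
theorem d₁_eq_lieDeriv_sub (𝒢 : LieGroupoid I J G M) (μ : PairField I G → G → ℝ)
    (Z W : PairField I G) (g : G) : 𝒢.d₁ μ Z W g = 𝒢.lieDeriv Z μ W g - d₀ (μ Z) W g := by
  rw [lieDeriv]; ring

omit [I.Boundaryless] [IsManifold I ∞ G] in
theorem thetaMinus_eq_pointDeriv (L : G → ℝ) (Z : PairField I G) (g : G) :
    thetaMinus L Z g = -pointDeriv I L g (Z.1 g) := rfl

-- By the chain rule, a function pulled back along `s` is not changed to first order by vectors that
-- Ts kills. It disposes of β^*f on Vβ and of α^*f on Vα.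
omit [I.Boundaryless] [IsManifold I ∞ G] in
theorem pointDeriv_comp_eq_zero {s : G → M} (hs : ContMDiff I J ∞ s) {f : M → ℝ}
    (hf : ContMDiff J 𝓘(ℝ, ℝ) ∞ f) {g : G} {w : TangentSpace I g} (hw : mfderiv I J s g w = 0) :
    pointDeriv I (fun h => f (s h)) g w = 0 := by
  have h1 := HasMFDerivAt.comp g ((hf.mdifferentiable (by simp)) (s g)).hasMFDerivAt
    ((hs.mdifferentiable (by simp)) g).hasMFDerivAt
  have h2 : pointDeriv I (fun h => f (s h)) g = (pointDeriv J f (s g)).comp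
      (mfderiv I J s g : E →L[ℝ] E') :=
    h1.mfderiv
  rw [h2]
  exact (congrArg (fun v : E' => pointDeriv J f (s g) v) hw).trans (map_zero _)

/-- `ℒ_{X^{(1,1)}} Θ_L^- = d(α^* f)` for a Noether symmetry. -/
theorem IsNoetherSymmetryWith.lieDeriv_thetaMinus [CompleteSpace E] {𝒢 : LieGroupoid I J G M}
    {L : G → ℝ} (hL : ContMDiff I 𝓘(ℝ, ℝ) ∞ L) {X : ∀ x : M, TangentSpace I (𝒢.one x)}
    {f : M → ℝ} (hX : 𝒢.IsNoetherSymmetryWith L X f) {Z : PairField I G} (hZ : 𝒢.IsSection Z)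
    (g : G) :
    𝒢.lieDeriv (𝒢.completeLift X) (thetaMinus L) Z g = d₀ (fun h => f (𝒢.src h)) Z g := by
  have hC := hX.isAlgebroidSection.isSection_completeLift
  set A₀ : ∀ g : G, TangentSpace I g := (𝒢.completeLift X).1 with hA₀
  set B₀ : ∀ g : G, TangentSpace I g := 𝒢.leftInvariant X with hB₀
  have hbr : pointDeriv I L g ((𝒢.bracket (𝒢.completeLift X) Z).1 g) =
      pointDeriv I L g (VectorField.mlieBracket I A₀ Z.1 g) +
        pointDeriv I L g (𝒢.fiberDeriv B₀ Z.1 g) := by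
    have h0 : (𝒢.fiberDeriv Z.2 A₀ g : E) = 0 :=
      hX.isAlgebroidSection.fiberDeriv_neg_rightInvariant Z.2 g
    have h1 : (𝒢.bracket (𝒢.completeLift X) Z).1 g =
        (VectorField.mlieBracket I A₀ Z.1 g + 𝒢.fiberDeriv B₀ Z.1 g) -
          𝒢.fiberDeriv Z.2 A₀ g := rfl
    have h2 : pointDeriv I L g (𝒢.fiberDeriv Z.2 A₀ g) = 0 :=
      (congrArg (fun v : E => pointDeriv I L g v) h0).trans (map_zero _)
    rw [h1, pointDeriv_map_sub, h2, sub_zero, pointDeriv_map_add]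
  have hA₀L := ((ContMDiffAt.mfderiv_apply_section hL (hC.smooth_fst g)).mdifferentiableAt
    (by simp)).hasMFDerivAt
  have hB₀L := ((ContMDiffAt.mfderiv_apply_section hL (hC.smooth_snd g)).mdifferentiableAt
    (by simp)).hasMFDerivAt
  -- The Noether condition differentiated along `Z.1`, which kills the β^*f term.
  have hsum : pointDeriv I (fun y => pointDeriv I L y (A₀ y)) g (Z.1 g) +
      pointDeriv I (fun y => pointDeriv I L y (B₀ y)) g (Z.1 g) =
      - pointDeriv I (fun h => f (𝒢.src h)) g (Z.1 g) := by
    have h1 : HasMFDerivAt I 𝓘(ℝ, ℝ)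
        (fun y => pointDeriv I L y (A₀ y) + pointDeriv I L y (B₀ y)) g
        (pointDeriv I (fun y => pointDeriv I L y (A₀ y)) g +
          pointDeriv I (fun y => pointDeriv I L y (B₀ y)) g) := hA₀L.add hB₀L
    have hfs : HasMFDerivAt I 𝓘(ℝ, ℝ) (fun h => f (𝒢.src h)) g
        (pointDeriv I (fun h => f (𝒢.src h)) g) :=
      (((hX.smooth.comp 𝒢.contMDiff_src).mdifferentiable (by simp)) g).hasMFDerivAt
    have hft : HasMFDerivAt I 𝓘(ℝ, ℝ) (fun h => f (𝒢.tgt h)) g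
        (pointDeriv I (fun h => f (𝒢.tgt h)) g) :=
      (((hX.smooth.comp 𝒢.contMDiff_tgt).mdifferentiable (by simp)) g).hasMFDerivAt
    have h2 : HasMFDerivAt I 𝓘(ℝ, ℝ) (fun h => f (𝒢.tgt h) - f (𝒢.src h)) g
        (pointDeriv I (fun h => f (𝒢.tgt h)) g - pointDeriv I (fun h => f (𝒢.src h)) g) :=
      hft.sub hfs
    have h3 : (fun y => pointDeriv I L y (A₀ y) + pointDeriv I L y (B₀ y)) =
        fun h => f (𝒢.tgt h) - f (𝒢.src h) :=
      funext fun y => (d₀_eq_pointDeriv L (𝒢.completeLift X) y).symm.trans (hX.quasiInvariant y)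
    rw [h3] at h1
    have h4 := DFunLike.congr_fun (hasMFDerivAt_unique h1 h2) (Z.1 g)
    have h5 : pointDeriv I (fun h => f (𝒢.tgt h)) g (Z.1 g) = 0 :=
      pointDeriv_comp_eq_zero 𝒢.contMDiff_tgt hX.smooth (hZ.vertical_fst g)
    have h6 : pointDeriv I (fun y => pointDeriv I L y (A₀ y)) g (Z.1 g) +
      pointDeriv I (fun y => pointDeriv I L y (B₀ y)) g (Z.1 g) =
      pointDeriv I (fun h => f (𝒢.tgt h)) g (Z.1 g) -
        pointDeriv I (fun h => f (𝒢.src h)) g (Z.1 g) := h4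
    rw [h6, h5, zero_sub]
  have hθ : d₀ (thetaMinus L Z) (𝒢.completeLift X) g =
      -(pointDeriv I (fun y => pointDeriv I L y (Z.1 y)) g (A₀ g) +
        pointDeriv I (fun y => pointDeriv I L y (Z.1 y)) g (B₀ g)) := by
    have h1 : HasMFDerivAt I 𝓘(ℝ, ℝ) (thetaMinus L Z) g
        (-pointDeriv I (fun y => pointDeriv I L y (Z.1 y)) g) :=
      (((ContMDiffAt.mfderiv_apply_section hL (hZ.smooth_fst g)).mdifferentiableAt
        (by simp)).hasMFDerivAt).neg
    have h2 : pointDeriv I (thetaMinus L Z) g =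
      -pointDeriv I (fun y => pointDeriv I L y (Z.1 y)) g := h1.mfderiv
    have h3 : ∀ v : E, (-pointDeriv I (fun y => pointDeriv I L y (Z.1 y)) g) v =
      -pointDeriv I (fun y => pointDeriv I L y (Z.1 y)) g v := fun v => rfl
    rw [d₀_eq_pointDeriv, h2, neg_add]
    exact congrArg₂ (· + ·) (h3 (A₀ g)) (h3 (B₀ g))
  have hsnd : pointDeriv I (fun h => f (𝒢.src h)) g (Z.2 g) = 0 :=
    pointDeriv_comp_eq_zero 𝒢.contMDiff_src hX.smooth (hZ.vertical_snd g)
  have hcomm := pointDeriv_mlieBracket hL hC.smooth_fst hZ.smooth_fst g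
  have hfib := hX.isAlgebroidSection.pointDeriv_fiberDeriv_leftInvariant hZ.vertical_fst
    hZ.smooth_fst hL g
  rw [lieDeriv_eq, hθ, thetaMinus_eq_pointDeriv, hbr, d₀_eq_pointDeriv, hsnd]
  rw [← hA₀] at hcomm
  rw [← hB₀] at hfib
  -- `hcomm` and `hfib` cancel the derivatives of Z₁(L) along `A₀` and `B₀`; what remains is minus
  -- the left side of `hsum`.
  linarith

/-- The bracket is additive in its first argument. -/
theorem bracket_sub_left_fst [CompleteSpace E] (𝒢 : LieGroupoid I J G M) {Z₁ Z₂ W : PairField I G}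
    (h₁ : 𝒢.IsSection Z₁) (h₂ : 𝒢.IsSection Z₂) (hW : 𝒢.IsSection W) (g : G) :
    (𝒢.bracket (Z₁ - Z₂) W).1 g = (𝒢.bracket Z₁ W).1 g - (𝒢.bracket Z₂ W).1 g := by
  have d₁' := (h₁.smooth_fst g).mdifferentiableAt (by simp)
  have d₂' := (h₂.smooth_fst g).mdifferentiableAt (by simp)
  have d₃' := ((h₁.sub h₂).smooth_fst g).mdifferentiableAt (by simp)
  have hl : VectorField.mlieBracket I (Z₁ - Z₂).1 W.1 g =
      VectorField.mlieBracket I Z₁.1 W.1 g - VectorField.mlieBracket I Z₂.1 W.1 g := by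
    -- Additivity is applied to (Z₁ - Z₂) + Z₂ and solved for the bracket of the difference.
    have := VectorField.mlieBracket_add_left (I := I) (W := W.1) d₃' d₂'
    rw [Prod.fst_sub, sub_add_cancel] at this
    rw [Prod.fst_sub, this, add_sub_cancel_right]
  have hf1 : 𝒢.fiberDeriv (Z₁ - Z₂).2 W.1 g =
      𝒢.fiberDeriv Z₁.2 W.1 g - 𝒢.fiberDeriv Z₂.2 W.1 g := map_sub (_ : E →L[ℝ] E) _ _
  have hf2 : 𝒢.fiberDeriv W.2 (Z₁ - Z₂).1 g =
      𝒢.fiberDeriv W.2 Z₁.1 g - 𝒢.fiberDeriv W.2 Z₂.1 g :=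
    𝒢.fiberDeriv_sub h₁.vertical_fst h₁.smooth_fst h₂.vertical_fst h₂.smooth_fst W.2
      (hW.vertical_snd g)
  change VectorField.mlieBracket I (Z₁ - Z₂).1 W.1 g + 𝒢.fiberDeriv (Z₁ - Z₂).2 W.1 g -
    𝒢.fiberDeriv W.2 (Z₁ - Z₂).1 g =
    (VectorField.mlieBracket I Z₁.1 W.1 g + 𝒢.fiberDeriv Z₁.2 W.1 g - 𝒢.fiberDeriv W.2 Z₁.1 g) -
    (VectorField.mlieBracket I Z₂.1 W.1 g + 𝒢.fiberDeriv Z₂.2 W.1 g - 𝒢.fiberDeriv W.2 Z₂.1 g)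
  rw [hl, hf1, hf2]
  abel

/-- `Ω_L` is additive in its first argument. -/
theorem omega_sub_left [CompleteSpace E] (𝒢 : LieGroupoid I J G M)
    {L : G → ℝ} (hL : ContMDiff I 𝓘(ℝ, ℝ) ∞ L) {Z₁ Z₂ W : PairField I G}
    (h₁ : 𝒢.IsSection Z₁) (h₂ : 𝒢.IsSection Z₂) (hW : 𝒢.IsSection W) (g : G) :
    𝒢.omega L (Z₁ - Z₂) W g = 𝒢.omega L Z₁ W g - 𝒢.omega L Z₂ W g := by
  have hθ : thetaMinus L (Z₁ - Z₂) = fun g => thetaMinus L Z₁ g - thetaMinus L Z₂ g := by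
    funext y
    simp only [thetaMinus_eq_pointDeriv, Prod.fst_sub, Pi.sub_apply, pointDeriv_map_sub]
    ring
  have e1 : d₀ (thetaMinus L W) (Z₁ - Z₂) g =
      d₀ (thetaMinus L W) Z₁ g - d₀ (thetaMinus L W) Z₂ g := by
    simp only [d₀_eq_pointDeriv, Prod.fst_sub, Prod.snd_sub, Pi.sub_apply, pointDeriv_map_sub]
    ring
  have e2 : d₀ (thetaMinus L (Z₁ - Z₂)) W g =
      d₀ (thetaMinus L Z₁) W g - d₀ (thetaMinus L Z₂) W g := by
    rw [hθ]
    exact d₀_sub ((h₁.contMDiff_thetaMinus hL).mdifferentiable (by simp) g)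
      ((h₂.contMDiff_thetaMinus hL).mdifferentiable (by simp) g) W
  have e3 : thetaMinus L (𝒢.bracket (Z₁ - Z₂) W) g =
      thetaMinus L (𝒢.bracket Z₁ W) g - thetaMinus L (𝒢.bracket Z₂ W) g := by
    simp only [thetaMinus_eq_pointDeriv]
    rw [𝒢.bracket_sub_left_fst h₁ h₂ hW g, pointDeriv_map_sub]
    ring
  simp only [omega, d₁]
  rw [e1, e2, e3]; ring

/-- `i_{X^{(1,1)}} Ω_L = d(Θ_L^-(X^{(1,1)}) - α^* f)` for a Noether symmetry. -/
theorem IsNoetherSymmetryWith.isHamiltonianSection [CompleteSpace E] {𝒢 : LieGroupoid I J G M}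
    {L : G → ℝ} (hL : ContMDiff I 𝓘(ℝ, ℝ) ∞ L) {X : ∀ x : M, TangentSpace I (𝒢.one x)}
    {f : M → ℝ} (hX : 𝒢.IsNoetherSymmetryWith L X f) :
    𝒢.IsHamiltonianSection L (𝒢.noetherFunction L X f) (𝒢.completeLift X) where
  isSection := hX.isAlgebroidSection.isSection_completeLift
  contraction W hW g := by
    have h1 := d₀_sub
      ((hX.isAlgebroidSection.isSection_completeLift.contMDiff_thetaMinus hL).mdifferentiable
        (by simp) g) ((hX.smooth.comp 𝒢.contMDiff_src).mdifferentiable (by simp) g) W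
    rw [omega, d₁_eq_lieDeriv_sub, hX.lieDeriv_thetaMinus hL hW]
    refine Eq.trans ?_ h1.symm
    rw [neg_sub]
    rfl

/-- If `Ω_L` is nondegenerate, then a function has at most one Hamiltonian section. -/
theorem IsHamiltonianSection.unique [CompleteSpace E] {𝒢 : LieGroupoid I J G M}
    {L : G → ℝ} (hL : ContMDiff I 𝓘(ℝ, ℝ) ∞ L) (hreg : 𝒢.IsRegular L) {F : G → ℝ}
    {ξ η : PairField I G} (hξ : 𝒢.IsHamiltonianSection L F ξ)
    (hη : 𝒢.IsHamiltonianSection L F η) : ξ = η := by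
  have h : ∀ g, (ξ - η).1 g = 0 ∧ (ξ - η).2 g = 0 := fun g =>
    hreg.nondegenerate g (ξ - η) (hξ.isSection.sub hη.isSection) fun W hW => by
      rw [𝒢.omega_sub_left hL hξ.isSection hη.isSection hW, hξ.contraction W hW,
        hη.contraction W hW, sub_self]
  exact sub_eq_zero.1 (Prod.ext (funext fun g => (h g).1) (funext fun g => (h g).2))

end

end LieGroupoid

theorem proposition5p8
    {E : Type*} [NormedAddCommGroup E] [NormedSpace ℝ E] [FiniteDimensional ℝ E]
    {H : Type*} [TopologicalSpace H] {I : ModelWithCorners ℝ E H} [I.Boundaryless]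
    {E' : Type*} [NormedAddCommGroup E'] [NormedSpace ℝ E'] [FiniteDimensional ℝ E']
    {H' : Type*} [TopologicalSpace H'] {J : ModelWithCorners ℝ E' H'} [J.Boundaryless]
    {G : Type*} [TopologicalSpace G] [ChartedSpace H G] [IsManifold I ∞ G]
    [T2Space G] [SecondCountableTopology G]
    {M : Type*} [TopologicalSpace M] [ChartedSpace H' M] [IsManifold J ∞ M]
    [T2Space M] [SecondCountableTopology M]
    (𝒢 : LieGroupoid I J G M)
    (L : G → ℝ) (hL : ContMDiff I 𝓘(ℝ, ℝ) ∞ L)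
    (X : ∀ x : M, TangentSpace I (𝒢.one x)) (f : M → ℝ)
    (hX : 𝒢.IsNoetherSymmetryWith L X f) :
    (∀ Z, 𝒢.IsSection Z → ∀ g,
      𝒢.lieDeriv (𝒢.completeLift X) (LieGroupoid.thetaMinus L) Z g =
        LieGroupoid.d₀ (fun h => f (𝒢.src h)) Z g) ∧
    (𝒢.IsRegular L →
      ContMDiff I 𝓘(ℝ, ℝ) ∞ (𝒢.noetherFunction L X f) ∧
      𝒢.IsHamiltonianSection L (𝒢.noetherFunction L X f) (𝒢.completeLift X) ∧
      ∀ ξ, 𝒢.IsHamiltonianSection L (𝒢.noetherFunction L X f) ξ → ξ = 𝒢.completeLift X) := by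
  -- The Lie bracket lemmas require a complete model space, which finite dimension provides.
  have : CompleteSpace E := FiniteDimensional.complete ℝ E
  have hC := hX.isAlgebroidSection.isSection_completeLift
  have hham := hX.isHamiltonianSection hL
  exact ⟨fun Z hZ g => hX.lieDeriv_thetaMinus hL hZ g, fun hreg =>
    ⟨(hC.contMDiff_thetaMinus hL).sub (hX.smooth.comp 𝒢.contMDiff_src), hham,
      fun ξ hξ => hξ.unique hL hreg hham⟩⟩
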